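/- Let $V\subset V'$ be an immediate extension of valuation rings, i.e. the inclusion is local and induces isomorphisms of the residue fields and of the value groups, and let $K\subset K'$ be the corresponding extension of fraction fields. Write $\operatorname{val}$ for the valuations of $K$ and $K'$ (with $\operatorname{val}(0)=\infty$). For a limit ordinal $\lambda>0$, a sequence $(v_i)_{i<\lambda}$ in $V$ is \emph{pseudo-convergent} if $\operatorname{val}(v_i-v_{i''})<\operatorname{val}(v_{i'}-v_{i''})$ for all $i<i'<i''<\lambda$; an element $z$ of $K'$ is a \emph{pseudo limit} of it if $\operatorname{val}(z-v_i)<\operatorname{val}(z-v_{i'})$ for all $i<i'<\lambda$. The sequence is \emph{algebraic} if some $f\in V[T]$ satisfies $\operatorname{val}(f(v_i))<\operatorname{val}(f(v_{i'}))$ for all large enough $i<i'<\lambda$, and \emph{transcendental} if each $f\in V[T]$ satisfies $\operatorname{val}(f(v_i))=\operatorname{val}(f(v_{i'}))$ for all large enough $i<i'<\lambda$. A \emph{complete intersection} $V$-algebra is a $V$-algebra isomorphic to $G/(P)$, where $G$ is a smooth $V$-algebra and $P$ is a finite regular sequence of elements of $G$ (flatness over $V$ is not required). Let $(v_j)_{j<\lambda}$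 be an algebraic pseudo-convergent sequence in $V$ with a pseudo limit $x$ in $V'$, but having no pseudo limit in $K$. Assume that $x$ is transcendental over $K$ and $K'=K(x)$. Then at least one of the following holds: (1) $V'$ is a filtered union of its complete intersection $V$-subalgebras, i.e. $V'$ is the union of a family, directed by inclusion, of $V$-subalgebras of $V'$ each of which is a complete intersection $V$-algebra; (2) there exists an element $y\in K'\setminus K$ which is a pseudo limit of a transcendental pseudo-convergent sequence in $V$ (indexed by some limit ordinal, possibly different from $\lambda$) that has no pseudo limit in $V$. -/

import Mathlib

universe u v w

/-! ### Pseudo-convergent sequences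

Valuations are written multiplicatively in Mathlib, with the order reversed with respect to the
additive notation: `val a < val b` becomes `ν b < ν a`, and `val 0 = ∞` becomes `ν 0 = 0`.
A sequence `(s i)`, `i < lam`, is a function on the set `Set.Iio lam` of ordinals below `lam`. -/

section PseudoConvergence

variable {F : Type v} [Field F] {Γ₀ : Type w} [LinearOrderedCommGroupWithZero Γ₀]

/-- `(s i)_{i < lam}` is pseudo-convergent: `lam` is a (nonzero) limit ordinal and
`val (s i - s i'') < val (s i' - s i'')` for all `i < i' < i'' < lam`. -/
def IsPseudoConvergent (ν : Valuation F Γ₀) {lam : Ordinal.{u}} (s : Set.Iio lam → F) : Prop :=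
  Order.IsSuccLimit lam ∧
    ∀ i i' i'' : Set.Iio lam, i < i' → i' < i'' → ν (s i' - s i'') < ν (s i - s i'')

/-- `x` is a pseudo limit of `(s i)_{i < lam}`: `val (x - s i) < val (x - s i')` for all
`i < i' < lam`. -/
def IsPseudoLimit (ν : Valuation F Γ₀) {lam : Ordinal.{u}} (s : Set.Iio lam → F) (x : F) : Prop :=
  ∀ i i' : Set.Iio lam, i < i' → ν (x - s i') < ν (x - s i)

/-- `(s i)_{i < lam}` is algebraic (with respect to polynomials over the ring `A`): there is a
polynomial `f` over `A` with `val (f (s i)) < val (f (s i'))` for all large enough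
`i < i' < lam`. -/
def IsAlgebraicSeq (A : Type u) [CommRing A] [Algebra A F] (ν : Valuation F Γ₀)
    {lam : Ordinal.{u}} (s : Set.Iio lam → F) : Prop :=
  ∃ f : Polynomial A, ∃ i₀ : Set.Iio lam, ∀ i i' : Set.Iio lam, i₀ ≤ i → i < i' →
    ν (Polynomial.aeval (s i') f) < ν (Polynomial.aeval (s i) f)

/-- `(s i)_{i < lam}` is transcendental (with respect to polynomials over the ring `A`): every
polynomial `f` over `A` satisfies `val (f (s i)) = val (f (s i'))` for all large enough
`i < i' < lam`. -/
def IsTranscendentalSeq (A : Type u) [CommRing A] [Algebra A F] (ν : Valuation F Γ₀)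
    {lam : Ordinal.{u}} (s : Set.Iio lam → F) : Prop :=
  ∀ f : Polynomial A, ∃ i₀ : Set.Iio lam, ∀ i i' : Set.Iio lam, i₀ ≤ i → i < i' →
    ν (Polynomial.aeval (s i) f) = ν (Polynomial.aeval (s i') f)

end PseudoConvergence

/-! ### Immediate extensions of valuation rings -/

/-- An extension `V → V'` of valuation rings with fraction fields `K → K'` is immediate: it is
local, and the maps it induces on residue fields and on value groups are isomorphisms.
(An isomorphism of the groups with zero that is compatible with the valuations of `K` and `K'`
is necessarily the one induced by `V → V'`.) -/
structure IsImmediateExtension (V V' K K' : Type*)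
    [CommRing V] [IsDomain V] [ValuationRing V] [Field K] [Algebra V K] [IsFractionRing V K]
    [CommRing V'] [IsDomain V'] [ValuationRing V'] [Field K'] [Algebra V' K']
    [IsFractionRing V' K'] [Algebra V V'] [Algebra K K'] : Prop where
  isLocalHom : IsLocalHom (algebraMap V V')
  residueField_bijective :
    Function.Bijective (IsLocalRing.ResidueField.map (algebraMap V V'))
  valueGroup_iso :
    ∃ φ : ValuationRing.ValueGroup V K ≃*o ValuationRing.ValueGroup V' K',
      ∀ z : K, φ (ValuationRing.valuation V K z) =
        ValuationRing.valuation V' K' (algebraMap K K' z)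

/-! ### Complete intersection algebras and filtered unions -/

/-- A complete intersection `A`-algebra: an `A`-algebra isomorphic to `G/(P)`, where `G` is a
smooth `A`-algebra and `P` is a (finite) regular sequence of elements of `G`. No flatness over
`A` is required. -/
def IsCompleteIntersectionAlgebra (A : Type u) (B : Type v) [CommRing A] [CommRing B]
    [Algebra A B] : Prop :=
  ∃ (G : Type u) (_ : CommRing G) (_ : Algebra A G) (P : List G),
    Algebra.Smooth A G ∧ RingTheory.Sequence.IsRegular G P ∧
      Nonempty ((G ⧸ Ideal.ofList P) ≃ₐ[A] B)

/-- `B` is the filtered union of a (directed by inclusion) family of `A`-subalgebras that satisfy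
the property `p`. -/
def IsFilteredUnionOf {A : Type u} {B : Type v} [CommRing A] [CommRing B] [Algebra A B]
    (p : Subalgebra A B → Prop) : Prop :=
  ∃ S : Set (Subalgebra A B),
    (∀ C ∈ S, p C) ∧ DirectedOn (· ≤ ·) S ∧ ∀ b : B, ∃ C ∈ S, b ∈ C

/-! Alternative (1) is the one established. Complete intersection subalgebras are finitely
generated, so it suffices to put every finite subset of `V'` into one of them. As `K' = K(x)`, the
elements of such a subset are quotients of integral values at `x` of finitely many polynomials, the
denominators having value `1`.

Coordinates on `V'` are built by induction on the degree. Immediacy gives a monic `g` of top degree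
and a scalar `e` with `g(x)/e` in the maximal ideal, such that each given polynomial is a
`V`-multiple of `g/e` plus a polynomial of lower degree with integral value. In degree one, `g(x)/e`
is the transcendental element `y 0`. In higher degree, `g(x)` is a sum of terms (scalar)(unit)`(y
r)^j` in the last coordinate `y r`. Either `g(x)/e` is already available, or division by the first
scalar of largest value gives `β * y (r + 1) = G(y 0, …, y r)`, where `y (r + 1)` is a unit multiple
of `g(x)/e`, `β` is in the maximal ideal `𝔪` of `V`, and `G` is congruent mod `𝔪` to `h * Y_r ^ m`
with `h(0)` a unit (`exists_chain_extension`, `exists_isRelationChain`).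

Near the origin of the closed fibre the equations `P_j = G_j - β_j Y_{j+1}` are units times powers
of distinct variables, so each is regular modulo the earlier ones. By the local criterion of
flatness, applied over a Noetherian local subring, the quotients by initial segments have no
`V`-torsion at the origin (`IsTriangularSystem.exists_isUnit_mul_mem`). Over `K` the equations
merely eliminate variables, so up to torsion they generate all relations among the `y i`. Locally,
then, each initial segment generates the prime ideal of relations. These ideals are finitely
generated because `V` is a valuation ring (`ValuationRing.ker_aeval_fg`), so inverting one element
suffices, and the `P_j` become a regular sequence in a smooth algebra. -/

/-! ### Finite presentation of torsion-free algebras over a valuation ring -/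

section FinitePresentation

open MvPolynomial

/-- A finite nonempty family in a valuation ring has a member dividing all the others. -/
theorem ValuationRing.exists_mem_forall_dvd {V : Type*} [CommRing V] [IsDomain V] [ValuationRing V]
    {ι : Type*} (s : Finset ι) (hs : s.Nonempty) (f : ι → V) :
    ∃ i ∈ s, ∀ j ∈ s, f i ∣ f j := by
  classical
  induction hs using Finset.Nonempty.cons_induction with
  | singleton a => exact ⟨a, by simp, by simp⟩
  | cons a s ha hs ih =>
    obtain ⟨i, hi, h⟩ := ih
    rcases ValuationRing.dvd_total (f a) (f i) with h' | h'
    · refine ⟨a, by simp, fun j hj => ?_⟩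
      rcases Finset.mem_cons.1 hj with rfl | hj
      · exact dvd_rfl
      · exact h'.trans (h j hj)
    · refine ⟨i, by simp [hi], fun j hj => ?_⟩
      rcases Finset.mem_cons.1 hj with rfl | hj
      · exact h'
      · exact h j hj

/-- A polynomial with coefficients in the maximal ideal of a valuation ring is divisible by an
element of the maximal ideal. -/
theorem MvPolynomial.exists_eq_C_mul_of_coeff_mem {V : Type*} [CommRing V] [IsDomain V]
    [ValuationRing V] {σ : Type*} (F : MvPolynomial σ V)
    (hF : ∀ m, coeff m F ∈ IsLocalRing.maximalIdeal V) :
    ∃ μ ∈ IsLocalRing.maximalIdeal V, ∃ F' : MvPolynomial σ V, F = C μ * F' := by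
  classical
  rcases F.support.eq_empty_or_nonempty with h | h
  · exact ⟨0, Ideal.zero_mem _, 0, by simpa using h⟩
  · obtain ⟨m, -, hm⟩ := ValuationRing.exists_mem_forall_dvd F.support h (fun m => coeff m F)
    refine ⟨coeff m F, hF m, ?_⟩
    have : C (coeff m F) ∣ F := by
      rw [C_dvd_iff_dvd_coeff]
      intro i
      by_cases hi : i ∈ F.support
      · exact hm i hi
      · rw [notMem_support_iff.1 hi]; exact dvd_zero _
    exact this

/-- A finite torsion-free module over a valuation ring is free. -/
theorem ValuationRing.free_of_finite_of_isTorsionFree {V : Type*} [CommRing V] [IsDomain V]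
    [ValuationRing V] (M : Type*) [AddCommGroup M] [Module V M] [Module.Finite V M]
    [Module.IsTorsionFree V M] : Module.Free V M := by
  have : Module.Flat V M := by
    rw [Module.Flat.flat_iff_torsion_eq_bot_of_isBezout,
      ← Submodule.isTorsionFree_iff_torsion_eq_bot]
    infer_instance
  exact Module.free_of_flat_of_isLocalRing

/-- The homogeneous polynomials of degree `d` that vanish at `w`. -/
noncomputable def homogeneousRelations (V : Type*) {B τ : Type*} [CommRing V] [CommRing B] [Algebra V B]
    (w : τ → B) (d : ℕ) : Submodule V (MvPolynomial τ V) :=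
  homogeneousSubmodule τ V d ⊓ LinearMap.ker (aeval w : MvPolynomial τ V →ₐ[V] B).toLinearMap

/-- The forms of degree `d` have a finitely generated torsion-free image in `B`; it is free, hence
finitely presented, so the kernel is finitely generated. This is the finiteness that Nakayama's
lemma needs. -/
theorem homogeneousRelations_fg {V B τ : Type*} [CommRing V] [IsDomain V] [ValuationRing V]
    [CommRing B] [Algebra V B] [Module.IsTorsionFree V B] [Finite τ] (w : τ → B) (d : ℕ) :
    (homogeneousRelations V w d).FG := by
  have : Module.Finite V (homogeneousSubmodule τ V d) :=
    Module.Finite.iff_fg.2 (homogeneousSubmodule_fg τ V d)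
  let l : homogeneousSubmodule τ V d →ₗ[V] B :=
    (aeval w : MvPolynomial τ V →ₐ[V] B).toLinearMap ∘ₗ (homogeneousSubmodule τ V d).subtype
  have hfree : Module.Free V (LinearMap.range l) :=
    ValuationRing.free_of_finite_of_isTorsionFree _
  have hfp : Module.FinitePresentation V (LinearMap.range l) :=
    Module.finitePresentation_of_projective _ _
  have h1 : (LinearMap.ker l.rangeRestrict).FG :=
    Module.FinitePresentation.fg_ker _ l.surjective_rangeRestrict
  rw [LinearMap.ker_rangeRestrict] at h1
  have h2 : homogeneousRelations V w d = (LinearMap.ker l).map (homogeneousSubmodule τ V d).subtype := by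
    ext F
    simp only [homogeneousRelations, Submodule.mem_inf, LinearMap.mem_ker, Submodule.mem_map, l]
    constructor
    · rintro ⟨h, h'⟩
      exact ⟨⟨F, h⟩, h', rfl⟩
    · rintro ⟨⟨F, h⟩, h', rfl⟩
      exact ⟨h, h'⟩
  rw [h2]
  exact h1.map _

/-- The homogeneous relations over a valuation ring are generated in finitely many degrees. -/
theorem exists_finset_homogeneousRelations_le {V B τ : Type*} [CommRing V] [IsDomain V]
    [ValuationRing V] [CommRing B] [Algebra V B] [Module.IsTorsionFree V B] [Finite τ] (w : τ → B) :
    ∃ s : Finset (MvPolynomial τ V), (∀ F ∈ s, aeval w F = 0) ∧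
      ∀ d, ∀ F ∈ homogeneousRelations V w d, F ∈ Ideal.span (s : Set (MvPolynomial τ V)) := by
  classical
  let _ : GradedAlgebra (homogeneousSubmodule τ V) := MvPolynomial.gradedAlgebra
  let 𝔪 := IsLocalRing.maximalIdeal V
  let π : MvPolynomial τ V →+* MvPolynomial τ (IsLocalRing.ResidueField V) :=
    map (IsLocalRing.residue V)
  have hπ : Function.Surjective π := map_surjective _ IsLocalRing.residue_surjective
  -- Over the residue field, Hilbert's basis theorem yields finitely many relations whose reductions
  -- generate the reductions of all homogeneous relations; Nakayama, one degree at a time, lifts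
  -- this to `V`.
  let W : Set (MvPolynomial τ V) := ⋃ d, homogeneousRelations V w d
  obtain ⟨t, htW, ht⟩ := (Submodule.fg_span_iff_fg_span_finset_subset (π '' W)).1
    ((isNoetherianRing_iff_ideal_fg (MvPolynomial τ (IsLocalRing.ResidueField V))).1
      inferInstance (Ideal.span (π '' W)))
  obtain ⟨s, hsW, rfl⟩ := Finset.subset_set_image_iff.1 htW
  have hsker : ∀ F ∈ s, aeval w F = 0 := by
    intro F hF
    obtain ⟨d, hd⟩ := Set.mem_iUnion.1 (hsW hF)
    exact hd.2
  have hI0 : Ideal.span (s : Set (MvPolynomial τ V)) ≤ RingHom.ker (aeval w : _ →ₐ[V] B) :=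
    Ideal.span_le.2 fun F hF => hsker F hF
  have hhom : (Ideal.span (s : Set (MvPolynomial τ V))).IsHomogeneous (homogeneousSubmodule τ V) := by
    refine Ideal.homogeneous_span _ _ fun F hF => ?_
    obtain ⟨d, hd⟩ := Set.mem_iUnion.1 (hsW hF)
    exact ⟨d, hd.1⟩
  refine ⟨s, hsker, fun d F hF => ?_⟩
  refine Submodule.le_of_le_smul_of_le_jacobson_bot (I := 𝔪)
    (N := (Ideal.span (s : Set (MvPolynomial τ V))).restrictScalars V)
    (homogeneousRelations_fg w d) (IsLocalRing.maximalIdeal_le_jacobson _) (fun F hF => ?_) hF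
  have h1 : π F ∈ (Ideal.span (s : Set (MvPolynomial τ V))).map π := by
    rw [Ideal.map_span, ← Finset.coe_image]
    change _ ∈ Submodule.span _ _
    rw [← ht]
    exact Ideal.subset_span ⟨F, Set.mem_iUnion.2 ⟨d, hF⟩, rfl⟩
  obtain ⟨H, hH, hHF⟩ := (Ideal.mem_map_iff_of_surjective π hπ).1 h1
  -- Only the component of degree `d` matters: the ideal is homogeneous, and `F` is a form of degree
  -- `d`.
  set H' := homogeneousComponent d H with hH'
  have hH'mem : H' ∈ Ideal.span (s : Set (MvPolynomial τ V)) :=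
    (mem_iff_homogeneousComponent_mem hhom H).1 hH d
  have hcoeff : ∀ m, coeff m (F - H') ∈ 𝔪 := by
    intro m
    have h2 : π (F - H') = 0 := by
      have h3 : π H' = homogeneousComponent d (π H) := by
        ext m
        simp only [π, hH', coeff_map, coeff_homogeneousComponent]
        split_ifs <;> simp
      rw [map_sub, h3, hHF, sub_eq_zero]
      have h4 : (π F).IsHomogeneous d := IsHomogeneous.map hF.1 _
      rw [homogeneousComponent_of_mem h4, if_pos rfl]
    have h5 := congrArg (coeff m) h2
    rw [coeff_map, coeff_zero] at h5
    exact (IsLocalRing.residue_eq_zero_iff _).1 h5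
  obtain ⟨μ, hμ, F', hF'⟩ := exists_eq_C_mul_of_coeff_mem _ hcoeff
  have hFsub : F - H' ∈ homogeneousRelations V w d :=
    sub_mem hF ⟨homogeneousComponent_isHomogeneous d H, hI0 hH'mem⟩
  have hsum : F = H' + (F - H') := by ring
  rw [hsum]
  refine Submodule.add_mem_sup hH'mem ?_
  -- The error is `μ * F'`. As `B` is torsion-free, `F'` is again a relation, so the error lies in
  -- `𝔪` times the module of relations.
  by_cases hμ0 : μ = 0
  · rw [hF', hμ0]; simp
  rw [hF', ← smul_eq_C_mul]
  refine Submodule.smul_mem_smul hμ ⟨?_, ?_⟩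
  · have h6 : (C μ * F').IsHomogeneous d := hF' ▸ hFsub.1
    change F'.IsHomogeneous d
    intro m hm
    apply h6
    rw [coeff_C_mul]
    exact mul_ne_zero hμ0 hm
  · have h7 : aeval w (C μ * F') = 0 := hF' ▸ hFsub.2
    rw [← smul_eq_C_mul, map_smul] at h7
    exact (smul_eq_zero_iff_right hμ0).1 h7

/-- Asking for all large degrees, not one, lets the summands of a sum be homogenized in a common
degree. -/
theorem MvPolynomial.exists_homogenization {R σ : Type*} [CommRing R] (f : MvPolynomial σ R) :
    ∃ D, ∀ d ≥ D, ∃ F : MvPolynomial (Option σ) R, F.IsHomogeneous d ∧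
      aeval (fun o : Option σ => o.elim 1 X) F = f := by
  induction f using MvPolynomial.induction_on with
  | C a =>
    refine ⟨0, fun d _ => ⟨C a * X none ^ d, ?_, ?_⟩⟩
    · simpa using (isHomogeneous_C (Option σ) a).mul (isHomogeneous_X_pow (R := R) none d)
    · simp
  | add p q hp hq =>
    obtain ⟨D, hD⟩ := hp
    obtain ⟨E, hE⟩ := hq
    refine ⟨max D E, fun d hd => ?_⟩
    obtain ⟨F, hF, hF'⟩ := hD d (le_of_max_le_left hd)
    obtain ⟨G, hG, hG'⟩ := hE d (le_of_max_le_right hd)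
    exact ⟨F + G, hF.add hG, by rw [map_add, hF', hG']⟩
  | mul_X p i hp =>
    obtain ⟨D, hD⟩ := hp
    refine ⟨D + 1, fun d hd => ?_⟩
    obtain ⟨F, hF, hF'⟩ := hD (d - 1) (by omega)
    refine ⟨F * X (some i), ?_, by rw [map_mul, hF', aeval_X]; rfl⟩
    have := hF.mul (isHomogeneous_X R (some i))
    rwa [Nat.sub_add_cancel (by omega)] at this

/-- A finitely generated torsion-free algebra over a valuation ring is finitely presented. -/
theorem ValuationRing.ker_aeval_fg {V B σ : Type*} [CommRing V] [IsDomain V]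
    [ValuationRing V] [CommRing B] [Algebra V B] [Module.IsTorsionFree V B] [Finite σ] (w : σ → B) :
    (RingHom.ker (aeval w : MvPolynomial σ V →ₐ[V] B)).FG := by
  classical
  -- The homogenizing variable is sent to `1`, so dehomogenization matches relations of `w'` with
  -- relations of `w`.
  let w' : Option σ → B := fun o => o.elim 1 w
  let δ : MvPolynomial (Option σ) V →ₐ[V] MvPolynomial σ V := aeval (fun o => o.elim 1 X)
  have hδ : ∀ F, aeval w (δ F) = aeval w' F := by
    intro F
    have : (aeval w).comp δ = aeval w' := by
      ext o
      cases o <;> simp [δ, w']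
    rw [← this]; rfl
  obtain ⟨s, hs, h⟩ := exists_finset_homogeneousRelations_le (V := V) w'
  refine ⟨s.image δ, le_antisymm (Ideal.span_le.2 ?_) fun f hf => ?_⟩
  · intro f hf
    obtain ⟨F, hF, rfl⟩ := Finset.mem_image.1 (Finset.mem_coe.1 hf)
    change aeval w (δ F) = 0
    rw [hδ, hs F hF]
  · obtain ⟨D, hD⟩ := exists_homogenization f
    obtain ⟨F, hF, hF'⟩ := hD D le_rfl
    have h1 : aeval w' F = 0 := by rw [← hδ]; rw [show δ F = f from hF']; exact hf
    have h2 := Ideal.mem_map_of_mem δ (h D F ⟨hF, h1⟩)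
    rw [Ideal.map_span] at h2
    rw [show δ F = f from hF'] at h2
    simpa using h2

end FinitePresentation

/-! ### The local criterion of flatness -/

section LocalFlatness

open MvPolynomial IsLocalRing

/-- Krull's intersection theorem for `S ⧸ I`. -/
theorem IsLocalRing.mem_of_forall_mem_sup_pow {S : Type*} [CommRing S] [IsLocalRing S]
    [IsNoetherianRing S] (I : Ideal S) (x : S) (h : ∀ n, x ∈ I ⊔ maximalIdeal S ^ n) : x ∈ I := by
  have h1 := Ideal.iInf_pow_smul_eq_bot_of_isLocalRing (M := S ⧸ I) (maximalIdeal S)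
    (Ideal.IsPrime.ne_top inferInstance)
  rw [← Ideal.Quotient.eq_zero_iff_mem, ← Submodule.mem_bot (R := S), ← h1, Submodule.mem_iInf]
  intro n
  obtain ⟨y, hy, z, hz, rfl⟩ := Submodule.mem_sup.1 (h n)
  rw [map_add, Ideal.Quotient.eq_zero_iff_mem.2 hy, zero_add]
  have : Ideal.Quotient.mk I z = z • (1 : S ⧸ I) := by
    rw [Algebra.smul_def, mul_one]; rfl
  rw [this]
  exact Submodule.smul_mem_smul hz trivial

/-- `S ⧸ N` is flat over `R`, expressed through colon ideals: `(J(S/N) : a) = (J : a)(S/N)`. -/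
def IsColonFlat (R : Type*) {S : Type*} [CommRing R] [CommRing S] [Algebra R S] (N : Ideal S) :
    Prop :=
  ∀ (J J' : Ideal R) (a : R), (∀ b, b * a ∈ J → b ∈ J') →
    ∀ x, algebraMap R S a * x ∈ N ⊔ J.map (algebraMap R S) → x ∈ N ⊔ J'.map (algebraMap R S)

variable {R S : Type*} [CommRing R] [CommRing S] [Algebra R S] [IsLocalRing R] [IsNoetherianRing R]

/-- Noetherian induction from `J = ⊤` downwards, climbing a filtration of `R ⧸ J` with residue field
quotients. If `a ∉ J` and `𝔪 a ⊆ J`, the case of `J + (a)` gives `x = y + a t`. Flatness turns `a (f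
t) ∈ N + JS` into `f t ∈ N + 𝔪S`; then `t ∈ N + 𝔪S`, and `a t ∈ N + JS`. -/
theorem IsColonFlat.mem_of_mul_mem_of_pow_le {N : Ideal S} (hN : IsColonFlat R N) (f : S)
    (hf : ∀ x, f * x ∈ N ⊔ (maximalIdeal R).map (algebraMap R S) →
      x ∈ N ⊔ (maximalIdeal R).map (algebraMap R S)) (J : Ideal R) :
    (∃ n, maximalIdeal R ^ n ≤ J) → ∀ x, f * x ∈ N ⊔ J.map (algebraMap R S) →
      x ∈ N ⊔ J.map (algebraMap R S) := by
  classical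
  induction J using WellFoundedGT.induction with
  | ind J ih =>
  intro hJ x hx
  by_cases hJtop : J = ⊤
  · rw [hJtop, Ideal.map_top, sup_top_eq]; trivial
  have hn := Nat.find_spec hJ
  have hn0 : Nat.find hJ ≠ 0 := by
    intro h0
    rw [h0, pow_zero, Ideal.one_eq_top, top_le_iff] at hn
    exact hJtop hn
  obtain ⟨k, hk⟩ := Nat.exists_eq_succ_of_ne_zero hn0
  have hk' : ¬ maximalIdeal R ^ k ≤ J := Nat.find_min hJ (by omega)
  obtain ⟨a, ha, haJ⟩ := SetLike.not_le_iff_exists.1 hk'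
  have hma : ∀ b ∈ maximalIdeal R, b * a ∈ J := by
    intro b hb
    apply hn
    rw [hk, pow_succ']
    exact Ideal.mul_mem_mul hb ha
  have hcol : ∀ b, b * a ∈ J → b ∈ maximalIdeal R := by
    intro b hb
    rw [mem_maximalIdeal]
    intro hu
    exact haJ ((Ideal.unit_mul_mem_iff_mem J hu).1 hb)
  have hlt : J < J ⊔ Ideal.span {a} := by
    refine lt_of_le_of_ne le_sup_left fun h => haJ ?_
    rw [h]
    exact Ideal.mem_sup_right (Ideal.mem_span_singleton_self a)
  have hle : N ⊔ J.map (algebraMap R S) ≤ N ⊔ (J ⊔ Ideal.span {a}).map (algebraMap R S) :=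
    sup_le_sup_left (Ideal.map_mono hlt.le) _
  have h1 := ih _ hlt (hJ.imp fun n h => h.trans hlt.le) x (hle hx)
  rw [Ideal.map_sup, ← sup_assoc, Ideal.map_span, Set.image_singleton] at h1
  obtain ⟨y, hy, z, hz, rfl⟩ := Submodule.mem_sup.1 h1
  obtain ⟨t, rfl⟩ := Ideal.mem_span_singleton.1 hz
  refine Ideal.add_mem _ hy ?_
  have h2 : algebraMap R S a * (f * t) ∈ N ⊔ J.map (algebraMap R S) := by
    have h3 := Ideal.sub_mem _ hx (Ideal.mul_mem_left _ f hy)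
    convert h3 using 1
    ring
  have h4 := hf t (hN J _ a hcol _ h2)
  have h5 : ∀ w ∈ (maximalIdeal R).map (algebraMap R S),
      algebraMap R S a * w ∈ J.map (algebraMap R S) := by
    intro w hw
    refine Submodule.span_induction ?_ (by simp) ?_ ?_ hw
    · rintro _ ⟨b, hb, rfl⟩
      rw [← map_mul, mul_comm]
      exact Ideal.mem_map_of_mem _ (hma b hb)
    · intro u v _ _ hu hv
      rw [mul_add]; exact Ideal.add_mem _ hu hv
    · intro c u _ hu
      rw [smul_eq_mul, mul_left_comm]; exact Ideal.mul_mem_left _ _ hu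
  obtain ⟨p, hp, q, hq, rfl⟩ := Submodule.mem_sup.1 h4
  rw [mul_add]
  exact Submodule.add_mem_sup (Ideal.mul_mem_left _ _ hp) (h5 q hq)

variable [IsLocalRing S] [IsNoetherianRing S]

/-- The previous case applies to `J + 𝔪 ^ n` for every `n`; Krull's theorem removes the power. -/
theorem IsColonFlat.mem_of_mul_mem {N : Ideal S} (hN : IsColonFlat R N)
    (hm : (maximalIdeal R).map (algebraMap R S) ≤ maximalIdeal S) (f : S)
    (hf : ∀ x, f * x ∈ N ⊔ (maximalIdeal R).map (algebraMap R S) →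
      x ∈ N ⊔ (maximalIdeal R).map (algebraMap R S)) (J : Ideal R) (x : S)
    (hx : f * x ∈ N ⊔ J.map (algebraMap R S)) : x ∈ N ⊔ J.map (algebraMap R S) := by
  refine IsLocalRing.mem_of_forall_mem_sup_pow _ _ fun n => ?_
  have h1 := hN.mem_of_mul_mem_of_pow_le f hf (J ⊔ maximalIdeal R ^ n) ⟨n, le_sup_right⟩ x
    ((show N ⊔ J.map (algebraMap R S) ≤ _ from sup_le_sup le_rfl (Ideal.map_mono le_sup_left)) hx)
  rw [Ideal.map_sup, ← sup_assoc, Ideal.map_pow] at h1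
  exact (show N ⊔ J.map (algebraMap R S) ⊔ _ ≤ _ from
    sup_le_sup le_rfl (Ideal.pow_right_mono hm n)) h1

/-- A form of the local criterion of flatness: dividing by an element that is regular on the
closed fibre preserves flatness. -/
theorem IsColonFlat.sup_span {N : Ideal S} (hN : IsColonFlat R N)
    (hm : (maximalIdeal R).map (algebraMap R S) ≤ maximalIdeal S) (f : S)
    (hf : ∀ x, f * x ∈ N ⊔ (maximalIdeal R).map (algebraMap R S) →
      x ∈ N ⊔ (maximalIdeal R).map (algebraMap R S)) :
    IsColonFlat R (N ⊔ Ideal.span {f}) := by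
  intro J J' a hJ x hx
  have hcomm : ∀ A : Ideal S, N ⊔ Ideal.span {f} ⊔ A = N ⊔ A ⊔ Ideal.span {f} :=
    fun A => sup_right_comm _ _ _
  rw [hcomm] at hx ⊢
  obtain ⟨y, hy, z, hz, hyz⟩ := Submodule.mem_sup.1 hx
  obtain ⟨t, rfl⟩ := Ideal.mem_span_singleton.1 hz
  have h1 : f * t ∈ N ⊔ (J ⊔ Ideal.span {a}).map (algebraMap R S) := by
    rw [Ideal.map_sup, ← sup_assoc, Ideal.map_span, Set.image_singleton]
    have : f * t = -y + algebraMap R S a * x := by rw [← hyz]; ring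
    rw [this]
    exact Submodule.add_mem_sup (neg_mem hy)
      (Ideal.mul_mem_right _ _ (Ideal.mem_span_singleton_self _))
  -- Cancelling `f` modulo `J + (a)` gives `t = u + a t'`, so `a` multiplies the corrected element
  -- `x - f t'` into `N + JS`, where flatness modulo `N` applies.
  have h2 := hN.mem_of_mul_mem hm f hf _ _ h1
  rw [Ideal.map_sup, ← sup_assoc, Ideal.map_span, Set.image_singleton] at h2
  obtain ⟨u, hu, v, hv, huv⟩ := Submodule.mem_sup.1 h2
  obtain ⟨t', rfl⟩ := Ideal.mem_span_singleton.1 hv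
  have h3 : algebraMap R S a * (x - f * t') ∈ N ⊔ J.map (algebraMap R S) := by
    have : algebraMap R S a * (x - f * t') = y + f * u := by
      rw [mul_sub, ← hyz, ← huv]; ring
    rw [this]
    exact Ideal.add_mem _ hy (Ideal.mul_mem_left _ _ hu)
  have h4 := hN J J' a hJ _ h3
  have : x = (x - f * t') + f * t' := by ring
  rw [this]
  exact Submodule.add_mem_sup h4 (Ideal.mul_mem_right _ _ (Ideal.mem_span_singleton_self _))

end LocalFlatness

/-! ### Triangular systems over a Noetherian local ring -/

section TriangularSystems

open MvPolynomial IsLocalRing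

/-- Let `ε` set `X i` to zero. Since `ε` fixes the generators, `l - ε l` is `X i` times an element
of the ideal for every `l` in it. For `l = X i * f` the term `ε l` vanishes, and `X i` cancels. -/
theorem MvPolynomial.mem_of_X_mul_mem_span {R σ : Type*} [CommRing R] [DecidableEq σ] (i : σ)
    (G : Set (MvPolynomial σ R))
    (hG : ∀ g ∈ G, aeval (fun k => if k = i then (0 : MvPolynomial σ R) else X k) g = g)
    (f : MvPolynomial σ R) (hf : X i * f ∈ Ideal.span G) : f ∈ Ideal.span G := by
  let ε : MvPolynomial σ R →ₐ[R] MvPolynomial σ R := aeval (fun k => if k = i then 0 else X k)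
  have hε : ∀ w, ∃ w', w - ε w = X i * w' := by
    intro w
    have h1 : (Ideal.Quotient.mkₐ R (Ideal.span {(X i : MvPolynomial σ R)})).comp ε =
        Ideal.Quotient.mkₐ R _ := by
      ext k
      simp only [AlgHom.comp_apply, ε, aeval_X]
      split_ifs with h
      · subst h
        rw [map_zero]
        exact (Ideal.Quotient.eq_zero_iff_mem.2 (Ideal.mem_span_singleton_self _)).symm
      · rfl
    have h2 : Ideal.Quotient.mk (Ideal.span {(X i : MvPolynomial σ R)}) (w - ε w) = 0 := by
      rw [map_sub, sub_eq_zero]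
      exact (DFunLike.congr_fun h1 w).symm
    rw [Ideal.Quotient.eq_zero_iff_mem, Ideal.mem_span_singleton] at h2
    exact h2
  have key : ∀ l ∈ Ideal.span G, ∃ w ∈ Ideal.span G, l - ε l = X i * w := by
    intro l hl
    refine Submodule.span_induction (p := fun l _ => ∃ w ∈ Ideal.span G, l - ε l = X i * w)
      ?_ ⟨0, zero_mem _, by simp⟩ ?_ ?_ hl
    · intro g hg
      exact ⟨0, zero_mem _, by rw [show ε g = g from hG g hg]; simp⟩
    · rintro a b - - ⟨u, hu, hu'⟩ ⟨v, hv, hv'⟩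
      exact ⟨u + v, add_mem hu hv, by rw [map_add, mul_add, ← hu', ← hv']; ring⟩
    · rintro a b hb ⟨u, hu, hu'⟩
      obtain ⟨a', ha'⟩ := hε a
      refine ⟨a' * b + ε a * u, add_mem (Ideal.mul_mem_left _ _ hb) (Ideal.mul_mem_left _ _ hu), ?_⟩
      rw [smul_eq_mul, map_mul, mul_add, ← mul_assoc, ← ha', mul_left_comm, ← hu']
      ring
  obtain ⟨w, hw, h⟩ := key _ hf
  have h0 : ε (X i * f) = 0 := by simp [ε]
  rw [h0, sub_zero] at h
  have h3 : (X i : MvPolynomial σ R) * (f - w) = 0 := by rw [mul_sub, h, sub_self]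
  have h4 : f - w = 0 := by
    have := (MvPolynomial.isRegular_X (R := R) (n := i)).left
    exact this (by simpa using h3)
  rw [sub_eq_zero] at h4
  rwa [h4]

/-- A sequence of polynomials `P j`, `j < r`, that reduces to `(unit) * (X (ix j)) ^ e j` modulo the
maximal ideal of the base ring. -/
structure IsTriangularSystem {R σ : Type*} [CommRing R] [IsLocalRing R] (r : ℕ) (ix : ℕ → σ)
    (P h : ℕ → MvPolynomial σ R) (e : ℕ → ℕ) : Prop where
  injOn : Set.InjOn ix (Set.Iio r)
  isUnit : ∀ j < r, IsUnit (constantCoeff (h j))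
  coeff_mem : ∀ j < r, ∀ k, coeff k (P j - h j * X (ix j) ^ e j) ∈ maximalIdeal R

/-- The ideal generated by `P i` for `i < j`. -/
def prefixIdeal {A : Type*} [CommRing A] (P : ℕ → A) (j : ℕ) : Ideal A := Ideal.span (P '' Set.Iio j)

theorem prefixIdeal_succ {A : Type*} [CommRing A] (P : ℕ → A) (j : ℕ) :
    prefixIdeal P (j + 1) = prefixIdeal P j ⊔ Ideal.span {P j} := by
  rw [prefixIdeal, prefixIdeal, ← Ideal.span_union]
  congr 1
  ext x
  simp only [Set.mem_image, Set.mem_Iio, Set.mem_union, Set.mem_singleton_iff]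
  constructor
  · rintro ⟨i, hi, rfl⟩
    rcases Nat.lt_succ_iff_lt_or_eq.1 hi with h | rfl
    · exact Or.inl ⟨i, h, rfl⟩
    · exact Or.inr rfl
  · rintro (⟨i, hi, rfl⟩ | rfl)
    · exact ⟨i, by omega, rfl⟩
    · exact ⟨j, by omega, rfl⟩

/-- After localization at the origin of the closed fibre, `P j` becomes there a unit times a power
of a variable not used before, hence is regular modulo its predecessors. The local criterion makes
the quotient by each initial segment flat over `R`, so `c` stays a nonzerodivisor on it. Polynomials
with unit constant coefficient are the denominators. -/
theorem IsTriangularSystem.exists_isUnit_mul_mem_of_isNoetherianRing {R σ : Type*} [CommRing R]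
    [IsLocalRing R] [IsNoetherianRing R] [Finite σ] {r : ℕ} {ix : ℕ → σ}
    {P h : ℕ → MvPolynomial σ R} {e : ℕ → ℕ} (H : IsTriangularSystem r ix P h e) {j : ℕ}
    (hj : j ≤ r) (c : R) (hc : ∀ b, b * c = 0 → b = 0) (u : MvPolynomial σ R)
    (hu : C c * u ∈ prefixIdeal P j) :
    ∃ s, IsUnit (constantCoeff s) ∧ s * u ∈ prefixIdeal P j := by
  classical
  let q : Ideal (MvPolynomial σ R) := RingHom.ker ((residue R).comp constantCoeff)
  have hq : q.IsPrime := RingHom.ker_isPrime _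
  have hmemq : ∀ s, s ∈ q.primeCompl ↔ IsUnit (constantCoeff s) := by
    intro s
    change ¬ (residue R) (constantCoeff s) = 0 ↔ _
    rw [residue_eq_zero_iff, mem_maximalIdeal, mem_nonunits_iff, not_not]
  let S := Localization.AtPrime q
  let φ := algebraMap (MvPolynomial σ R) S
  have hunit : ∀ s, IsUnit (constantCoeff s) → IsUnit (φ s) := fun s hs =>
    IsLocalization.map_units S (⟨s, (hmemq s).2 hs⟩ : q.primeCompl)
  have hSnoeth : IsNoetherianRing S := IsLocalization.isNoetherianRing q.primeCompl S inferInstance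
  have hmap : ∀ J : Ideal R, J.map (algebraMap R S) = (J.map C).map φ := by
    intro J
    rw [Ideal.map_map]
    rfl
  have hm : (maximalIdeal R).map (algebraMap R S) ≤ maximalIdeal S := by
    rw [hmap, ← Localization.AtPrime.map_eq_maximalIdeal]
    refine Ideal.map_mono (Ideal.map_le_iff_le_comap.2 fun b hb => ?_)
    change (residue R) (constantCoeff (C b)) = 0
    rw [constantCoeff_C, residue_eq_zero_iff]
    exact hb
  have hmemmap : ∀ (I : Ideal (MvPolynomial σ R)) (x : MvPolynomial σ R), φ x ∈ I.map φ →
      ∃ s, IsUnit (constantCoeff s) ∧ s * x ∈ I := by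
    intro I x hx
    obtain ⟨s, hs, h⟩ := (IsLocalization.algebraMap_mem_map_algebraMap_iff q.primeCompl S I x).1 hx
    exact ⟨s, (hmemq s).1 hs, h⟩
  have hmemmap' : ∀ (I : Ideal (MvPolynomial σ R)) (x s : MvPolynomial σ R),
      IsUnit (constantCoeff s) → s * x ∈ I → φ x ∈ I.map φ := by
    intro I x s hs h
    have := Ideal.mem_map_of_mem φ h
    rw [map_mul] at this
    exact (Ideal.unit_mul_mem_iff_mem _ (hunit s hs)).1 this
  have hsurj : ∀ x : S, ∃ p s, IsUnit (constantCoeff s) ∧ φ s * x = φ p := by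
    intro x
    obtain ⟨⟨p, s⟩, h⟩ := IsLocalization.surj q.primeCompl x
    exact ⟨p, s, (hmemq _).1 s.2, by rw [mul_comm]; exact h⟩
  -- The model of the closed fibre: pure powers of variables together with `𝔪`.
  let L : ℕ → Ideal (MvPolynomial σ R) := fun j =>
    Ideal.span ((fun i => X (ix i) ^ e i) '' Set.Iio j ∪ C '' (maximalIdeal R : Set R))
  have hCL : ∀ j, (maximalIdeal R).map (algebraMap R S) ≤ (L j).map φ := by
    intro j
    rw [hmap]
    exact Ideal.map_mono (Ideal.span_mono Set.subset_union_right)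
  have hP : ∀ i < r, φ (P i) - φ (h i) * φ (X (ix i) ^ e i) ∈
      (maximalIdeal R).map (algebraMap R S) := by
    intro i hi
    rw [← map_mul, ← map_sub, hmap]
    exact Ideal.mem_map_of_mem _ (mem_map_C_iff.2 (H.coeff_mem i hi))
  have hNL : ∀ j ≤ r, (prefixIdeal P j).map φ ⊔ (maximalIdeal R).map (algebraMap R S) =
      (L j).map φ := by
    intro j hj
    apply le_antisymm
    · refine sup_le ?_ (hCL j)
      rw [prefixIdeal, Ideal.map_span, Ideal.span_le]
      rintro _ ⟨_, ⟨i, hi, rfl⟩, rfl⟩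
      have h1 := Ideal.add_mem _ (hCL j (hP i (lt_of_lt_of_le hi hj)))
        (Ideal.mul_mem_left _ (φ (h i)) (Ideal.mem_map_of_mem φ (Ideal.subset_span
          (Or.inl ⟨i, hi, rfl⟩) : X (ix i) ^ e i ∈ L j)))
      rw [sub_add_cancel] at h1
      exact h1
    · rw [Ideal.map_span, Ideal.span_le, Set.image_union]
      rintro _ (⟨_, ⟨i, hi, rfl⟩, rfl⟩ | ⟨_, ⟨b, hb, rfl⟩, rfl⟩)
      · have hi' : i < r := lt_of_lt_of_le hi hj
        refine (Ideal.unit_mul_mem_iff_mem _ (hunit (h i) (H.isUnit i hi'))).1 ?_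
        change φ (h i) * φ (X (ix i) ^ e i) ∈ _
        have h1 := Submodule.add_mem_sup (Ideal.mem_map_of_mem φ
          (Ideal.subset_span ⟨i, hi, rfl⟩ : P i ∈ prefixIdeal P j)) (neg_mem (hP i hi'))
        have h2 : φ (h i) * φ (X (ix i) ^ e i) =
            φ (P i) + -(φ (P i) - φ (h i) * φ (X (ix i) ^ e i)) := by ring
        rw [h2]
        exact h1
      · exact Ideal.mem_sup_right (Ideal.mem_map_of_mem _ hb)
  have hXL : ∀ j < r, ∀ (n : ℕ) (f : MvPolynomial σ R), X (ix j) ^ n * f ∈ L j → f ∈ L j := by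
    intro j hj n
    induction n with
    | zero => intro f hf; simpa using hf
    | succ n ih =>
      intro f hf
      refine ih _ (mem_of_X_mul_mem_span (ix j) _ ?_ _ (by rwa [pow_succ', mul_assoc] at hf))
      rintro _ (⟨i, hi, rfl⟩ | ⟨b, hb, rfl⟩)
      · have : ix i ≠ ix j := fun h =>
          (ne_of_lt (show i < j from hi)) (H.injOn (lt_trans hi hj : i < r) hj h)
        simp [this]
      · simp
  have hreg : ∀ j < r, ∀ x, φ (P j) * x ∈
      (prefixIdeal P j).map φ ⊔ (maximalIdeal R).map (algebraMap R S) →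
      x ∈ (prefixIdeal P j).map φ ⊔ (maximalIdeal R).map (algebraMap R S) := by
    intro j hj x hx
    rw [hNL j hj.le] at hx ⊢
    have h1 : φ (h j) * (φ (X (ix j) ^ e j) * x) ∈ (L j).map φ := by
      have := Ideal.sub_mem _ hx (Ideal.mul_mem_right x _ (hCL j (hP j hj)))
      convert this using 1
      ring
    rw [Ideal.unit_mul_mem_iff_mem _ (hunit _ (H.isUnit j hj))] at h1
    obtain ⟨p, s, hs, hps⟩ := hsurj x
    have h2 : φ (X (ix j) ^ e j * p) ∈ (L j).map φ := by
      rw [map_mul, ← hps, mul_left_comm]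
      exact Ideal.mul_mem_left _ _ h1
    obtain ⟨t, ht, h3⟩ := hmemmap _ _ h2
    rw [mul_left_comm] at h3
    have h4 := hmemmap' _ _ t ht (hXL j hj _ _ h3)
    rw [← hps] at h4
    exact (Ideal.unit_mul_mem_iff_mem _ (hunit s hs)).1 h4
  have hflat0 : IsColonFlat R (⊥ : Ideal S) := by
    intro J J' a hJ x hx
    rw [bot_sup_eq, hmap] at hx ⊢
    obtain ⟨p, s, hs, hps⟩ := hsurj x
    have h1 : φ (C a * p) ∈ (J.map C).map φ := by
      rw [map_mul, ← hps, mul_left_comm]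
      exact Ideal.mul_mem_left _ _ hx
    obtain ⟨t, ht, h2⟩ := hmemmap _ _ h1
    rw [mul_left_comm, mem_map_C_iff] at h2
    have h3 : t * p ∈ J'.map C := by
      rw [mem_map_C_iff]
      intro k
      refine hJ _ ?_
      have := h2 k
      rwa [coeff_C_mul, mul_comm] at this
    have h4 := hmemmap' _ _ t ht h3
    rw [← hps] at h4
    exact (Ideal.unit_mul_mem_iff_mem _ (hunit s hs)).1 h4
  have hflat : ∀ j ≤ r, IsColonFlat R ((prefixIdeal P j).map φ) := by
    intro j
    induction j with
    | zero => intro _; simpa [prefixIdeal] using hflat0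
    | succ j ih =>
      intro hj
      rw [prefixIdeal_succ, Ideal.map_sup, Ideal.map_span, Set.image_singleton]
      exact (ih (by omega)).sup_span hm _ (hreg j (by omega))
  -- Flatness is used only for `(0 : c) = 0`.
  have h1 := hflat j hj ⊥ ⊥ c (fun b hb => hc b hb) (φ u) (by
    rw [Ideal.map_bot, sup_bot_eq]
    have := Ideal.mem_map_of_mem φ hu
    rwa [map_mul] at this)
  rw [Ideal.map_bot, sup_bot_eq] at h1
  exact hmemmap _ _ h1

end TriangularSystems

/-! ### Descent to Noetherian local subrings -/

section NoetherianDescent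

open MvPolynomial IsLocalRing

theorem mem_prefixIdeal_iff {A : Type*} [CommRing A] {P : ℕ → A} {j : ℕ} {x : A} :
    x ∈ prefixIdeal P j ↔ ∃ w : ℕ → A, x = ∑ i ∈ Finset.range j, w i * P i := by
  constructor
  · intro hx
    induction j generalizing x with
    | zero => exact ⟨0, by simpa [prefixIdeal] using hx⟩
    | succ j ih =>
      rw [prefixIdeal_succ] at hx
      obtain ⟨y, hy, z, hz, rfl⟩ := Submodule.mem_sup.1 hx
      obtain ⟨t, rfl⟩ := Ideal.mem_span_singleton'.1 hz
      obtain ⟨w, rfl⟩ := ih hy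
      refine ⟨Function.update w j t, ?_⟩
      rw [Finset.sum_range_succ, Function.update_self]
      congr 1
      refine Finset.sum_congr rfl fun i hi => ?_
      rw [Function.update_of_ne (Finset.mem_range.1 hi).ne]
  · rintro ⟨w, rfl⟩
    exact Ideal.sum_mem _ fun i hi => Ideal.mul_mem_left _ _
      (Ideal.subset_span ⟨i, Finset.mem_range.1 hi, rfl⟩)

/-- Finitely many elements of a local domain lie in a Noetherian local subring that it dominates. -/
theorem exists_isNoetherianRing_isLocalHom {V : Type u} [CommRing V] [IsDomain V] [IsLocalRing V]
    (t : Finset V) :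
    ∃ (R : Type u) (_ : CommRing R) (_ : IsLocalRing R) (_ : IsNoetherianRing R) (ι : R →+* V),
      Function.Injective ι ∧ IsLocalHom ι ∧ ∀ a ∈ t, a ∈ Set.range ι := by
  classical
  let A := Algebra.adjoin ℤ (t : Set V)
  have hA : IsNoetherianRing A := by
    have : Algebra.FiniteType ℤ A := (Subalgebra.fg_iff_finiteType _).1 ⟨t, rfl⟩
    exact Algebra.FiniteType.isNoetherianRing ℤ A
  let p : Ideal A := (maximalIdeal V).comap (algebraMap A V)
  have hp : p.IsPrime := inferInstance
  have hu : ∀ y : p.primeCompl, IsUnit (algebraMap A V y) := by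
    intro y
    have : (algebraMap A V y) ∉ maximalIdeal V := y.2
    simpa [mem_maximalIdeal] using this
  let ι : Localization.AtPrime p →+* V := IsLocalization.lift hu
  have hι : ∀ (a : A) (s : p.primeCompl), ι (IsLocalization.mk' _ a s) * algebraMap A V s = algebraMap A V a := by
    intro a s
    rw [← IsLocalization.lift_eq (S := Localization.AtPrime p) hu (s : A),
      ← IsLocalization.lift_eq (S := Localization.AtPrime p) hu a]
    change ι _ * ι _ = ι _
    rw [← map_mul, IsLocalization.mk'_spec]
  refine ⟨Localization.AtPrime p, inferInstance, inferInstance,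
    IsLocalization.isNoetherianRing p.primeCompl _ hA, ι, ?_, ⟨?_⟩, ?_⟩
  · rw [injective_iff_map_eq_zero]
    intro x hx
    obtain ⟨a, s, rfl⟩ := IsLocalization.exists_mk'_eq p.primeCompl x
    have h1 := hι a s
    rw [hx, zero_mul] at h1
    have h2 : a = 0 := Subtype.ext h1.symm
    rw [h2, IsLocalization.mk'_zero]
  · intro x hx
    obtain ⟨a, s, rfl⟩ := IsLocalization.exists_mk'_eq p.primeCompl x
    have h1 : IsUnit (algebraMap A V a) := by rw [← hι a s]; exact hx.mul (hu s)
    have ha : a ∈ p.primeCompl := by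
      change ¬ (algebraMap A V a ∈ maximalIdeal V)
      simpa [mem_maximalIdeal] using h1
    have h2 := IsLocalization.mk'_spec (Localization.AtPrime p) a s
    exact isUnit_of_mul_isUnit_left (h2 ▸ IsLocalization.map_units _ (⟨a, ha⟩ : p.primeCompl))
  · intro a ha
    refine ⟨algebraMap A _ ⟨a, Algebra.subset_adjoin ha⟩, ?_⟩
    rw [IsLocalization.lift_eq]
    rfl

/-- Torsion modulo the first members of a triangular system vanishes locally. -/
theorem IsTriangularSystem.exists_isUnit_mul_mem {V σ : Type*} [CommRing V] [IsDomain V]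
    [IsLocalRing V] [Finite σ] {r : ℕ} {ix : ℕ → σ}
    {P h : ℕ → MvPolynomial σ V} {e : ℕ → ℕ} (H : IsTriangularSystem r ix P h e) {j : ℕ}
    (hj : j ≤ r) (c : V) (hc : c ≠ 0) (u : MvPolynomial σ V)
    (hu : C c * u ∈ prefixIdeal P j) :
    ∃ s, IsUnit (constantCoeff s) ∧ s * u ∈ prefixIdeal P j := by
  classical
  obtain ⟨w, hw⟩ := mem_prefixIdeal_iff.1 hu
  -- The subring contains the coefficients of the system, of `u` and of the combination witnessing
  -- `hu`. Locality of `ι` carries units and the maximal ideal down to `R`.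
  obtain ⟨R, _, _, _, ι, hι, hloc, ht⟩ := exists_isNoetherianRing_isLocalHom
    (insert c (u.coeffs ∪ ((Finset.range r).biUnion fun i =>
      (P i).coeffs ∪ (h i).coeffs ∪ (w i).coeffs)))
  have lift : ∀ f : MvPolynomial σ V, (∀ a ∈ f.coeffs, a ∈ Set.range ι) → ∃ g, map ι g = f := by
    intro f hf
    exact mem_range_map_iff_coeffs_subset.2 fun a ha => hf a ha
  obtain ⟨c', rfl⟩ := ht c (by simp)
  obtain ⟨u', rfl⟩ := lift u fun a ha => ht a (by simp only [Finset.mem_insert, Finset.mem_union]; tauto)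
  have hl : ∀ i, ∃ p' h' w', i < r → map ι p' = P i ∧ map ι h' = h i ∧ map ι w' = w i := by
    intro i
    by_cases hi : i < r
    · have hmem : ∀ a ∈ (P i).coeffs ∪ (h i).coeffs ∪ (w i).coeffs, a ∈ Set.range ι := fun a ha =>
        ht a (Finset.mem_insert_of_mem (Finset.mem_union_right _
          (Finset.mem_biUnion.2 ⟨i, Finset.mem_range.2 hi, ha⟩)))
      simp only [Finset.mem_union] at hmem
      obtain ⟨p', hp'⟩ := lift (P i) fun a ha => hmem a (Or.inl (Or.inl ha))
      obtain ⟨h', hh'⟩ := lift (h i) fun a ha => hmem a (Or.inl (Or.inr ha))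
      obtain ⟨w', hw'⟩ := lift (w i) fun a ha => hmem a (Or.inr ha)
      exact ⟨p', h', w', fun _ => ⟨hp', hh', hw'⟩⟩
    · exact ⟨0, 0, 0, fun h => absurd h hi⟩
  choose P' h' w' hP using hl
  have H' : IsTriangularSystem r ix P' h' e := by
    refine ⟨H.injOn, fun i hi => ?_, fun i hi k => ?_⟩
    · have := H.isUnit i hi
      rw [← (hP i hi).2.1, constantCoeff_map] at this
      exact (isUnit_map_iff ι _).1 this
    · have := H.coeff_mem i hi k
      rw [← (hP i hi).2.1, ← (hP i hi).1, ← map_X (f := ι), ← map_pow, ← map_mul, ← map_sub,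
        coeff_map, mem_maximalIdeal, mem_nonunits_iff, isUnit_map_iff] at this
      exact this
  obtain ⟨s, hs, hsu⟩ := H'.exists_isUnit_mul_mem_of_isNoetherianRing hj c' (fun b hb => by
    have h1 := congrArg ι hb
    rw [map_mul, map_zero] at h1
    exact hι (by rw [map_zero]; exact (mul_eq_zero.1 h1).resolve_right hc)) u' (by
    rw [mem_prefixIdeal_iff]
    refine ⟨w', map_injective ι hι ?_⟩
    rw [map_mul, map_C, hw, map_sum]
    refine Finset.sum_congr rfl fun i hi => ?_
    have hi' := lt_of_lt_of_le (Finset.mem_range.1 hi) hj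
    rw [map_mul, (hP i hi').1, (hP i hi').2.2])
  refine ⟨map ι s, by rw [constantCoeff_map]; exact hs.map ι, ?_⟩
  rw [← map_mul]
  obtain ⟨v, hv⟩ := mem_prefixIdeal_iff.1 hsu
  rw [hv, map_sum]
  refine Ideal.sum_mem _ fun i hi => ?_
  have hi' := lt_of_lt_of_le (Finset.mem_range.1 hi) hj
  rw [map_mul, (hP i hi').1]
  exact Ideal.mul_mem_left _ _ (Ideal.subset_span ⟨i, Finset.mem_range.1 hi, rfl⟩)

end NoetherianDescent

/-! ### Complete intersections from prime initial segments -/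

section CompleteIntersection

open MvPolynomial IsLocalRing

theorem Ideal.FG.exists_mem_forall_mul_mem {S : Type*} [CommRing S] (M : Submonoid S)
    {I : Ideal S} (hI : I.FG) (N : Ideal S) (h : ∀ u ∈ I, ∃ s ∈ M, s * u ∈ N) :
    ∃ s ∈ M, ∀ u ∈ I, s * u ∈ N := by
  classical
  obtain ⟨t, rfl⟩ := hI
  choose! f hfM hf using h
  refine ⟨∏ a ∈ t, f a, Submonoid.prod_mem _ fun a ha => hfM a (Ideal.subset_span ha), fun u hu => ?_⟩
  refine Submodule.span_induction ?_ (by simp) ?_ ?_ hu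
  · intro a ha
    rw [← Finset.prod_erase_mul _ _ (Finset.mem_coe.1 ha), mul_assoc]
    exact Ideal.mul_mem_left _ _ (hf a (Ideal.subset_span ha))
  · intro x y _ _ hx hy
    rw [mul_add]; exact add_mem hx hy
  · intro a x _ hx
    rw [smul_eq_mul, mul_left_comm]; exact Ideal.mul_mem_left _ _ hx

theorem ofList_take_map_range {A : Type*} [CommRing A] (P : ℕ → A) (r i : ℕ) (hi : i ≤ r) :
    Ideal.ofList (((List.range r).map P).take i) = prefixIdeal P i := by
  rw [← List.map_take, List.take_range, min_eq_left hi]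
  change Ideal.span _ = _
  congr 1
  ext x
  simp

/-- If the ideals generated by the initial segments of `P` become prime after inverting `s`, the
localization at `s` of the image of the quotient is a complete intersection. -/
theorem exists_isCompleteIntersectionAlgebra_of_prime_prefixes {V : Type u} {V' : Type v}
    {S : Type u} [CommRing V] [CommRing V'] [IsDomain V'] [Algebra V V'] [CommRing S] [Algebra V S]
    [Algebra.Smooth V S] (P : ℕ → S) (r : ℕ) (I : ℕ → Ideal S) (hI : ∀ j ≤ r, (I j).IsPrime)
    (hPI : ∀ j ≤ r, ∀ i < j, P i ∈ I j) (hP : ∀ j < r, P j ∉ I j) (s : S) (hs : ∀ j ≤ r, s ∉ I j)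
    (hsI : ∀ j ≤ r, ∀ u ∈ I j, s * u ∈ prefixIdeal P j) (ψ : S →ₐ[V] V')
    (hψ : RingHom.ker ψ = I r) (hψs : IsUnit (ψ s)) :
    ∃ C : Subalgebra V V', IsCompleteIntersectionAlgebra V C ∧
      ∀ (f : S) (w : V'), w * ψ s = ψ f → w ∈ C := by
  let G := Localization.Away s
  let φ := algebraMap S G
  have hsu : IsUnit (φ s) := IsLocalization.Away.algebraMap_isUnit s
  have hpow : ∀ y : Submonoid.powers s, IsUnit (ψ y) := by
    rintro ⟨_, n, rfl⟩
    simpa using hψs.pow n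
  let Ψ : G →ₐ[V] V' := IsLocalization.liftAlgHom (M := Submonoid.powers s) (f := ψ) hpow
  have hΨ : ∀ x, Ψ (φ x) = ψ x := fun x => IsLocalization.lift_eq (M := Submonoid.powers s) _ x
  -- Once `s` is a unit, `hsI` makes the initial segments generate the extended primes `I j`.
  have hprefix : ∀ j ≤ r, prefixIdeal (fun i => φ (P i)) j = (I j).map φ := by
    intro j hj
    have h1 : prefixIdeal (fun i => φ (P i)) j = (prefixIdeal P j).map φ := by
      rw [prefixIdeal, prefixIdeal, Ideal.map_span, Set.image_image]
    rw [h1]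
    apply le_antisymm
    · refine Ideal.map_mono (Ideal.span_le.2 ?_)
      rintro _ ⟨i, hi, rfl⟩
      exact hPI j hj i hi
    · rw [Ideal.map_le_iff_le_comap]
      intro x hx
      have := Ideal.mem_map_of_mem φ (hsI j hj x hx)
      rw [map_mul] at this
      exact (Ideal.unit_mul_mem_iff_mem _ hsu).1 this
  have hmem : ∀ j ≤ r, ∀ x, φ x ∈ (I j).map φ ↔ x ∈ I j := by
    intro j hj x
    refine ⟨fun h => ?_, Ideal.mem_map_of_mem φ⟩
    have := hI j hj
    obtain ⟨_, ⟨n, rfl⟩, h'⟩ := (IsLocalization.algebraMap_mem_map_algebraMap_iff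
      (Submonoid.powers s) G (I j) x).1 h
    exact ((hI j hj).mem_or_mem h').resolve_left fun h => hs j hj ((hI j hj).mem_of_pow_mem n h)
  have hsurj : ∀ x : G, ∃ p t, IsUnit (φ t) ∧ φ t * x = φ p := by
    intro x
    obtain ⟨⟨p, t⟩, h⟩ := IsLocalization.surj (Submonoid.powers s) x
    exact ⟨p, t, IsLocalization.map_units G t, by rw [mul_comm]; exact h⟩
  have hker : RingHom.ker Ψ = (I r).map φ := by
    ext x
    obtain ⟨p, t, ht, h⟩ := hsurj x
    rw [← Ideal.unit_mul_mem_iff_mem (RingHom.ker Ψ) ht, ← Ideal.unit_mul_mem_iff_mem (.map φ _) ht,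
      h, hmem r le_rfl, ← hψ]
    change Ψ (φ p) = 0 ↔ ψ p = 0
    rw [hΨ]
  let L := (List.range r).map fun i => φ (P i)
  have hL : Ideal.ofList L = RingHom.ker Ψ.rangeRestrict := by
    have h1 := ofList_take_map_range (fun i => φ (P i)) r r le_rfl
    rw [List.take_of_length_le (by simp), hprefix r le_rfl, ← hker] at h1
    rw [h1]
    ext x
    simp only [RingHom.mem_ker]
    exact (Subtype.ext_iff (a1 := Ψ.rangeRestrict x) (a2 := 0)).symm
  refine ⟨Ψ.range, ⟨G, inferInstance, inferInstance, L, ?_, ⟨⟨fun i hi => ?_⟩, ?_⟩, ⟨?_⟩⟩, ?_⟩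
  · have : Algebra.Smooth S G := Algebra.Smooth.of_isLocalization_Away s
    exact Algebra.Smooth.comp V S G
  · have hi' : i < r := by simpa [L] using hi
    rw [ofList_take_map_range _ r i hi'.le, hprefix i hi'.le, smul_eq_mul, Ideal.mul_top,
      isSMulRegular_quotient_iff_mem_of_smul_mem]
    intro x hx
    have hLi : L[i] = φ (P i) := by simp [L]
    rw [hLi, smul_eq_mul] at hx
    obtain ⟨p, t, ht, h⟩ := hsurj x
    -- Regularity is primality: `P i` lies outside the prime generated by its predecessors.
    rw [← Ideal.unit_mul_mem_iff_mem _ ht, h, hmem i hi'.le]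
    have h2 := Ideal.mul_mem_left _ (φ t) hx
    rw [mul_left_comm, h, ← map_mul, hmem i hi'.le] at h2
    exact ((hI i hi'.le).mem_or_mem h2).resolve_left (hP i hi')
  · rw [smul_eq_mul, Ideal.mul_top, hL]
    intro h
    have h1 : (1 : G) ∈ RingHom.ker Ψ.rangeRestrict := h ▸ trivial
    rw [RingHom.mem_ker, map_one] at h1
    exact one_ne_zero h1
  · exact (Ideal.quotientEquivAlgOfEq V hL).trans
      (Ideal.quotientKerAlgEquivOfSurjective Ψ.rangeRestrict_surjective)
  · intro f w hw
    refine ⟨IsLocalization.mk' G f (⟨s, Submonoid.mem_powers s⟩ : Submonoid.powers s), ?_⟩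
    have h1 := congrArg Ψ (IsLocalization.mk'_spec G f
      (⟨s, Submonoid.mem_powers s⟩ : Submonoid.powers s))
    rw [map_mul] at h1
    erw [hΨ, hΨ] at h1
    rw [← hw] at h1
    exact mul_right_cancel₀ hψs.ne_zero h1

end CompleteIntersection

/-! ### Relation chains and their ideals of relations -/

section Chains

open MvPolynomial IsLocalRing

/-- A chain `y 0, …, y r` of elements of the maximal ideal of `V'`, with arbitrary further
elements `y i`, `r < i`: `y 0` is transcendental over `V`
and, for `j < r`, a multiple of `y (j + 1)` by a nonzero element of the maximal ideal of `V` is a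
polynomial in `y 0, …, y j` that reduces to `(unit) * (y j) ^ e`. -/
structure IsRelationChain (V : Type u) {V' : Type v} [CommRing V] [IsLocalRing V] [CommRing V']
    [IsLocalRing V'] [Algebra V V'] (r : ℕ) (y : ℕ → V') : Prop where
  mem : ∀ i, y i ∈ maximalIdeal V'
  transcendental : Transcendental V (y 0)
  step : ∀ j < r, ∃ (β : V) (G h : MvPolynomial ℕ V) (e : ℕ), β ≠ 0 ∧ β ∈ maximalIdeal V ∧
    G ∈ supported V (Set.Iic j) ∧ IsUnit (constantCoeff h) ∧
    (∀ k, coeff k (G - h * X j ^ e) ∈ maximalIdeal V) ∧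
    algebraMap V V' β * y (j + 1) = aeval y G

variable {V : Type u} {V' : Type v} [CommRing V] [CommRing V'] [Algebra V V']

/-- The substitution of `y i` for the variables with index `i < j`. -/
noncomputable def partialEval (V : Type u) {V' : Type v} [CommRing V] [CommRing V'] [Algebra V V']
    (r : ℕ) (y : ℕ → V') (j : ℕ) :
    MvPolynomial (Fin (r + 1)) V →ₐ[V] MvPolynomial (Fin (r + 1)) V' :=
  aeval fun k => if k.val < j then C (y k) else X k

theorem partialEval_X_of_lt {r : ℕ} {y : ℕ → V'} {j : ℕ} {k : Fin (r + 1)} (h : k.val < j) :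
    partialEval V r y j (X k) = C (y k) := by
  simp [partialEval, h]

theorem partialEval_X_of_not_lt {r : ℕ} {y : ℕ → V'} {j : ℕ} {k : Fin (r + 1)} (h : ¬ k.val < j) :
    partialEval V r y j (X k) = X k := by
  simp [partialEval, h]

theorem partialEval_C {r : ℕ} {y : ℕ → V'} {j : ℕ} (b : V) :
    partialEval V r y j (C b) = C (algebraMap V V' b) := by
  rw [partialEval, aeval_C]
  rfl

/-- Base case of the elimination: seen as polynomials over `V[Y_0]`, elements are mapped
coefficientwise by the injection `Y_0 ↦ y 0`. -/
theorem partialEval_one_injective {r : ℕ} {y : ℕ → V'} (hy : Transcendental V (y 0)) :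
    Function.Injective (partialEval V r y 1) := by
  let F : MvPolynomial (Fin (r + 1)) V →ₐ[V] MvPolynomial (Fin r) V' :=
    ((mapAlgHom (Polynomial.aeval (y 0))).comp
      (optionEquivRight V (Fin r) : _ →ₐ[V] _)).comp (rename (_root_.finSuccEquiv r))
  have hF : Function.Injective F := by
    have h1 : Function.Injective (mapAlgHom (σ := Fin r) (Polynomial.aeval (R := V) (y 0))) :=
      map_injective _ (transcendental_iff_injective.1 hy)
    have h2 := rename_injective (R := V) _ (_root_.finSuccEquiv r).injective
    intro a b hab
    exact h2 ((optionEquivRight V (Fin r)).injective (h1 hab))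
  let χ : MvPolynomial (Fin (r + 1)) V' →ₐ[V] MvPolynomial (Fin r) V' :=
    (aeval (Fin.cases 0 X) : _ →ₐ[V'] MvPolynomial (Fin r) V').restrictScalars V
  have h : F = χ.comp (partialEval V r y 1) := by
    ext1 k
    refine Fin.cases ?_ (fun i => ?_) k
    · rw [AlgHom.comp_apply χ, partialEval_X_of_lt (by simp)]
      simp [F, χ]
    · rw [AlgHom.comp_apply χ, partialEval_X_of_not_lt (by simp)]
      simp [F, χ]
  rw [h] at hF
  intro a b hab
  exact hF (congrArg χ hab)

theorem aeval_eq_of_mem_supported {A : Type*} [CommRing A] [Algebra V A] {s : Set ℕ}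
    {G : MvPolynomial ℕ V} (hG : G ∈ supported V s) {f g : ℕ → A} (hfg : Set.EqOn f g s) :
    aeval f G = aeval g G := by
  have h : Set.EqOn (aeval f : MvPolynomial ℕ V →ₐ[V] A) (aeval g) (X '' s) := by
    rintro _ ⟨i, hi, rfl⟩
    simpa using hfg hi
  exact AlgHom.eqOn_adjoin_iff.2 h hG

theorem aeval_sub_algebraMap_constantCoeff_mem {σ : Type*} (I : Ideal V') (w : σ → V')
    (hw : ∀ i, w i ∈ I) (f : MvPolynomial σ V) :
    aeval w f - algebraMap V V' (constantCoeff f) ∈ I := by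
  rw [← Ideal.Quotient.mk_eq_mk_iff_sub_mem]
  have h : ((Ideal.Quotient.mk I).comp (aeval w : MvPolynomial σ V →ₐ[V] V').toRingHom) =
      ((Ideal.Quotient.mk I).comp ((algebraMap V V').comp constantCoeff)) := by
    ext i
    · simp
    · simpa using Ideal.Quotient.eq_zero_iff_mem.2 (hw i)
  exact DFunLike.congr_fun h f

theorem partialEval_last (r : ℕ) (y : ℕ → V') (f : MvPolynomial (Fin (r + 1)) V) :
    partialEval V r y (r + 1) f = C (aeval (fun k : Fin (r + 1) => y k) f) := by
  have : partialEval V r y (r + 1) =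
      (IsScalarTower.toAlgHom V V' (MvPolynomial (Fin (r + 1)) V')).comp
        (aeval fun k : Fin (r + 1) => y k) := by
    ext1 k
    rw [partialEval_X_of_lt k.2]
    simp [algebraMap_eq]
  rw [this]
  rfl

/-- An element with nonzero value at `y` thus avoids all the kernels at once. -/
theorem ker_partialEval_le {r : ℕ} {y : ℕ → V'} {j : ℕ} {f : MvPolynomial (Fin (r + 1)) V}
    (hf : partialEval V r y j f = 0) : aeval (fun k : Fin (r + 1) => y k) f = 0 := by
  have h : (aeval fun k : Fin (r + 1) => y k) =
      ((aeval fun k : Fin (r + 1) => y k : _ →ₐ[V'] V').restrictScalars V).comp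
        (partialEval V r y j) := by
    ext1 k
    rw [AlgHom.comp_apply]
    by_cases hk : k.val < j
    · rw [partialEval_X_of_lt hk]; simp
    · rw [partialEval_X_of_not_lt hk]; simp
  rw [h, AlgHom.comp_apply, hf, map_zero]

/-- The defining equation `G - β Y_{j+1}` of a step in a chain. -/
noncomputable def stepRelation (r : ℕ) (β : V) (G : MvPolynomial ℕ V) (j : ℕ) :
    MvPolynomial (Fin (r + 1)) V :=
  rename (Fin.ofNat (r + 1)) G - C β * X (Fin.ofNat (r + 1) (j + 1))

/-- `Fin.ofNat (r + 1)` reduces indices modulo `r + 1`; this is harmless because `G` only involves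
indices at most `j ≤ r`. -/
theorem partialEval_rename {r : ℕ} {y : ℕ → V'} {j l : ℕ} (hj : j ≤ r) (hl : j < l)
    {G : MvPolynomial ℕ V} (hG : G ∈ supported V (Set.Iic j)) :
    partialEval V r y l (rename (Fin.ofNat (r + 1)) G) = C (aeval y G) := by
  have h1 : (partialEval V r y l).comp (rename (Fin.ofNat (r + 1))) =
      aeval fun i => partialEval V r y l (X (Fin.ofNat (r + 1) i)) := by
    ext1 i; simp
  have h2 : (IsScalarTower.toAlgHom V V' (MvPolynomial (Fin (r + 1)) V')).comp (aeval y) =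
      aeval fun i => C (y i) := by
    ext1 i; simp [algebraMap_eq]
  have h3 := DFunLike.congr_fun h1 G
  have h4 := DFunLike.congr_fun h2 G
  change partialEval V r y l (rename (Fin.ofNat (r + 1)) G) = _ at h3
  change C (aeval y G) = _ at h4
  rw [h3, h4]
  refine aeval_eq_of_mem_supported hG fun i (hi : i ≤ j) => ?_
  have hir : (Fin.ofNat (r + 1) i).val = i := Nat.mod_eq_of_lt (by omega)
  change partialEval V r y l (X (Fin.ofNat (r + 1) i)) = C (y i)
  rw [partialEval_X_of_lt (by omega), hir]

theorem partialEval_stepRelation {r : ℕ} {y : ℕ → V'} {j l : ℕ} (hj : j < r) (hl : j + 1 < l)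
    {β : V} {G : MvPolynomial ℕ V} (hG : G ∈ supported V (Set.Iic j))
    (h : algebraMap V V' β * y (j + 1) = aeval y G) :
    partialEval V r y l (stepRelation r β G j) = 0 := by
  have hjr : (Fin.ofNat (r + 1) (j + 1)).val = j + 1 := Nat.mod_eq_of_lt (by omega)
  rw [stepRelation, map_sub, partialEval_rename hj.le (by omega) hG, map_mul,
    partialEval_X_of_lt (by omega), hjr, partialEval_C, ← map_mul, h, sub_self]

/-- Before `y (j + 1)` is substituted, the linear term `-β Y_{j+1}` survives. This keeps each
relation outside the prime generated by its predecessors. -/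
theorem partialEval_stepRelation_ne_zero {r : ℕ} {y : ℕ → V'} {j : ℕ} (hj : j < r)
    {β : V} (hβ : algebraMap V V' β ≠ 0) {G : MvPolynomial ℕ V} (hG : G ∈ supported V (Set.Iic j)) :
    partialEval V r y (j + 1) (stepRelation r β G j) ≠ 0 := by
  have hjr : (Fin.ofNat (r + 1) (j + 1)).val = j + 1 := Nat.mod_eq_of_lt (by omega)
  rw [stepRelation, map_sub, partialEval_rename hj.le (by omega) hG, map_mul,
    partialEval_X_of_not_lt (by omega), partialEval_C]
  intro h
  have h1 := congrArg (coeff (Finsupp.single (Fin.ofNat (r + 1) (j + 1)) 1)) h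
  rw [coeff_sub, coeff_C_mul, coeff_X, coeff_zero, coeff_C, if_pos rfl,
    if_neg (Finsupp.single_ne_zero.2 one_ne_zero).symm, zero_sub, mul_one, neg_eq_zero] at h1
  exact hβ h1

theorem rename_mem_map_C {σ τ : Type*} (g : σ → τ) {I : Ideal V} {f : MvPolynomial σ V}
    (hf : f ∈ I.map C) : rename g f ∈ I.map (C : V →+* MvPolynomial τ V) := by
  have h1 := Ideal.mem_map_of_mem (rename g : MvPolynomial σ V →ₐ[V] MvPolynomial τ V).toRingHom hf
  have h2 : (rename g : MvPolynomial σ V →ₐ[V] MvPolynomial τ V).toRingHom.comp C = C := by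
    ext1 a; simp
  rw [Ideal.map_map, h2] at h1
  exact h1

/-- Eliminating one variable: modulo the relation `β Y_{j+1} = G`, a multiple of any polynomial does
not involve `Y_{j+1}`. -/
theorem exists_mul_sub_mem_span_stepRelation [IsDomain V] {r : ℕ} {y : ℕ → V'} {j : ℕ} (hj : j < r)
    {β : V} (hβ : β ≠ 0) {G : MvPolynomial ℕ V} (hG : G ∈ supported V (Set.Iic j))
    (u : MvPolynomial (Fin (r + 1)) V) :
    ∃ (c : V) (u' : MvPolynomial (Fin (r + 1)) V), c ≠ 0 ∧
      C c * u - u' ∈ Ideal.span {stepRelation r β G j} ∧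
      partialEval V r y (j + 1) u' = partialEval V r y (j + 2) u' := by
  have hjr : (Fin.ofNat (r + 1) (j + 1)).val = j + 1 := Nat.mod_eq_of_lt (by omega)
  induction u using MvPolynomial.induction_on with
  | C a =>
    refine ⟨1, C a, one_ne_zero, by simp, ?_⟩
    rw [partialEval_C, partialEval_C]
  | add p q hp hq =>
    obtain ⟨c, p', hc, hp, hp'⟩ := hp
    obtain ⟨d, q', hd, hq, hq'⟩ := hq
    refine ⟨c * d, C d * p' + C c * q', mul_ne_zero hc hd, ?_, ?_⟩
    · have := add_mem (Ideal.mul_mem_left _ (C d) hp) (Ideal.mul_mem_left _ (C c) hq)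
      convert this using 1
      rw [map_mul]; ring
    · simp only [map_add, map_mul, hp', hq', partialEval_C]
  | mul_X p i hp =>
    obtain ⟨c, p', hc, hp, hp'⟩ := hp
    by_cases hi : i = Fin.ofNat (r + 1) (j + 1)
    -- An extra factor `β` trades `β Y_{j+1}` for `G`, which is free of `Y_{j+1}`.
    · refine ⟨c * β, p' * rename (Fin.ofNat (r + 1)) G, mul_ne_zero hc hβ, ?_, ?_⟩
      · have h1 := Ideal.mul_mem_left _ (C β * X i) hp
        have h2 := Ideal.mul_mem_left _ p' (Ideal.mem_span_singleton_self (stepRelation r β G j))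
        have h3 := sub_mem h1 h2
        convert h3 using 1
        rw [map_mul, stepRelation, ← hi]; ring
      · rw [map_mul, map_mul, hp', partialEval_rename hj.le (by omega) hG,
          partialEval_rename hj.le (by omega) hG]
    · refine ⟨c, p' * X i, hc, ?_, ?_⟩
      · have h1 := Ideal.mul_mem_left _ (X i) hp
        convert h1 using 1
        ring
      · rw [map_mul, map_mul, hp']
        congr 1
        have hne : i.val ≠ j + 1 := fun h => hi (Fin.ext (by omega))
        by_cases h : i.val < j + 1
        · rw [partialEval_X_of_lt h, partialEval_X_of_lt (by omega)]
        · rw [partialEval_X_of_not_lt h, partialEval_X_of_not_lt (by omega)]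

/-- The localized algebra generated by a chain over a valuation ring is a complete intersection. -/
theorem IsRelationChain.exists_isCompleteIntersectionAlgebra [IsDomain V] [ValuationRing V] [IsDomain V']
    [IsLocalRing V'] [IsLocalHom (algebraMap V V')] (hinj : Function.Injective (algebraMap V V'))
    {r : ℕ} {y : ℕ → V'} (hy : IsRelationChain V r y) :
    ∃ s₀ : MvPolynomial (Fin (r + 1)) V, IsUnit (constantCoeff s₀) ∧
      ∀ s : MvPolynomial (Fin (r + 1)) V, IsUnit (constantCoeff s) →
      ∃ C : Subalgebra V V', IsCompleteIntersectionAlgebra V C ∧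
        ∀ (f : MvPolynomial (Fin (r + 1)) V) (w : V'),
          w * aeval (fun k : Fin (r + 1) => y k) (s₀ * s) = aeval (fun k : Fin (r + 1) => y k) f →
            w ∈ C := by
  classical
  have htf : Module.IsTorsionFree V V' := Module.isTorsionFree_iff_algebraMap_injective.mpr hinj
  have hst : ∀ j, ∃ (β : V) (G h : MvPolynomial ℕ V) (e : ℕ), j < r →
    (β ≠ 0 ∧ β ∈ maximalIdeal V ∧
    G ∈ supported V (Set.Iic j) ∧ IsUnit (constantCoeff h) ∧
    (∀ k, coeff k (G - h * X j ^ e) ∈ maximalIdeal V) ∧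
    algebraMap V V' β * y (j + 1) = aeval y G) := by
    intro j
    by_cases hj : j < r
    · obtain ⟨β, G, h, e, H⟩ := hy.step j hj
      exact ⟨β, G, h, e, fun _ => H⟩
    · exact ⟨0, 0, 0, 0, fun h => absurd h hj⟩
  choose β G h e H using hst
  let P : ℕ → MvPolynomial (Fin (r + 1)) V := fun j => stepRelation r (β j) (G j) j
  -- Since `β j ∈ 𝔪`, the term in `Y_{j+1}` disappears on the closed fibre.
  have hsys : IsTriangularSystem r (Fin.ofNat (r + 1)) P
      (fun j => rename (Fin.ofNat (r + 1)) (h j)) e := by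
    refine ⟨fun i hi j hj hij => ?_, fun j hj => ?_, fun j hj => ?_⟩
    · have := congrArg Fin.val hij
      simp only [Fin.val_ofNat] at this
      rwa [Nat.mod_eq_of_lt (Nat.lt_succ_of_lt hi), Nat.mod_eq_of_lt (Nat.lt_succ_of_lt hj)] at this
    · rw [constantCoeff_rename]; exact (H j hj).2.2.2.1
    · rw [← mem_map_C_iff]
      have h1 := mem_map_C_iff.2 (H j hj).2.2.2.2.1
      have h2 := rename_mem_map_C (Fin.ofNat (r + 1)) h1
      have h4 := Ideal.mul_mem_right (X (Fin.ofNat (r + 1) (j + 1))) _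
        (Ideal.mem_map_of_mem (C : V →+* MvPolynomial (Fin (r + 1)) V) (H j hj).2.1)
      convert sub_mem h2 h4 using 1
      simp only [P, stepRelation, map_sub, map_mul, map_pow, rename_X]
      ring
  -- Up to `V`-torsion the relations are generated by the `P i`: a multiple of `u` is congruent
  -- modulo `P j` to some `u'` without `Y_{j+1}`, which is then already killed by the shorter
  -- substitution.
  have hker : ∀ j ≤ r, ∀ u, partialEval V r y (j + 1) u = 0 →
      ∃ c : V, c ≠ 0 ∧ C c * u ∈ prefixIdeal P j := by
    intro j
    induction j with
    | zero =>
      intro _ u hu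
      refine ⟨1, one_ne_zero, ?_⟩
      rw [partialEval_one_injective hy.transcendental (hu.trans (map_zero _).symm), mul_zero]
      exact zero_mem _
    | succ j ih =>
      intro hj u hu
      have Hj := H j (by omega)
      obtain ⟨c, u', hc, hu', he⟩ := exists_mul_sub_mem_span_stepRelation (y := y)
        (show j < r by omega) Hj.1 Hj.2.2.1 u
      have h0 : partialEval V r y (j + 1) u' = 0 := by
        obtain ⟨t, ht⟩ := Ideal.mem_span_singleton.1 hu'
        have h1 := congrArg (partialEval V r y (j + 2)) ht
        rw [map_mul, partialEval_stepRelation (by omega) (by omega) Hj.2.2.1 Hj.2.2.2.2.2, zero_mul,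
          map_sub, map_mul, hu, mul_zero, zero_sub, neg_eq_zero] at h1
        rw [he, h1]
      obtain ⟨c', hc', h'⟩ := ih (by omega) u' h0
      refine ⟨c' * c, mul_ne_zero hc' hc, ?_⟩
      rw [prefixIdeal_succ]
      have h2 := add_mem (Ideal.mem_sup_left h' : C c' * u' ∈ _ ⊔ Ideal.span {P j})
        (Ideal.mem_sup_right (Ideal.mul_mem_left _ (C c') hu'))
      convert h2 using 1
      rw [map_mul]; ring
  let U : Submonoid (MvPolynomial (Fin (r + 1)) V) := (IsUnit.submonoid V).comap constantCoeff
  -- Torsion vanishes locally, and finite generation of the kernel gives one multiplier for the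
  -- whole kernel.
  have hfg : ∀ j, ∃ s ∈ U, j ≤ r → ∀ u ∈ RingHom.ker (partialEval V r y (j + 1)),
      s * u ∈ prefixIdeal P j := by
    intro j
    by_cases hj : j ≤ r
    · obtain ⟨s, hs, h'⟩ := Ideal.FG.exists_mem_forall_mul_mem U
        (ValuationRing.ker_aeval_fg
          (fun k : Fin (r + 1) => if k.val < j + 1 then C (y k) else X k)) (prefixIdeal P j)
        (fun u hu => by
          obtain ⟨c, hc, h'⟩ := hker j hj u hu
          exact hsys.exists_isUnit_mul_mem hj c hc u h')
      exact ⟨s, hs, fun _ => h'⟩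
    · exact ⟨1, one_mem _, fun h => absurd h hj⟩
  choose t htU ht using hfg
  refine ⟨∏ j ∈ Finset.range (r + 1), t j, Submonoid.prod_mem U fun j _ => htU j, fun s hs => ?_⟩
  have hsU : IsUnit (constantCoeff ((∏ j ∈ Finset.range (r + 1), t j) * s)) := by
    rw [map_mul]
    exact IsUnit.mul (Submonoid.prod_mem U fun j _ => htU j) hs
  have hunit : IsUnit (aeval (fun k : Fin (r + 1) => y k)
      ((∏ j ∈ Finset.range (r + 1), t j) * s)) := by
    have h1 := aeval_sub_algebraMap_constantCoeff_mem (maximalIdeal V')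
      (fun k : Fin (r + 1) => y k) (fun k => hy.mem k)
      ((∏ j ∈ Finset.range (r + 1), t j) * s)
    by_contra h2
    have h3 := sub_mem ((mem_maximalIdeal _).2 h2) h1
    rw [sub_sub_cancel] at h3
    exact h3 (hsU.map _)
  have hprime : ∀ j, (RingHom.ker (partialEval V r y j)).IsPrime := fun j => RingHom.ker_isPrime _
  have hsmooth : Algebra.Smooth V (MvPolynomial (Fin (r + 1)) V) := ⟨inferInstance, inferInstance⟩
  -- The shift by one is essential: `y 0` satisfies no relation, so the empty prefix corresponds to
  -- substituting `y 0` alone.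
  refine exists_isCompleteIntersectionAlgebra_of_prime_prefixes P r
    (fun j => RingHom.ker (partialEval V r y (j + 1))) (fun j _ => hprime _) ?_ ?_ _ ?_ ?_ _ ?_ hunit
  · intro j hj i hi
    have Hi := H i (by omega)
    exact partialEval_stepRelation (by omega) (by omega) Hi.2.2.1 Hi.2.2.2.2.2
  · intro j hj
    have Hj := H j hj
    exact partialEval_stepRelation_ne_zero hj
      (fun h => Hj.1 (hinj (h.trans (map_zero _).symm))) Hj.2.2.1
  · intro j _ hmem
    exact hunit.ne_zero (ker_partialEval_le hmem)
  · intro j hj u hu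
    rw [← Finset.mul_prod_erase _ _ (Finset.mem_range.2 (Nat.lt_succ_of_le hj)),
      mul_assoc, mul_right_comm]
    exact Ideal.mul_mem_right _ _ (ht j hj _ (Ideal.mul_mem_left _ s hu))
  · ext u
    simp only [RingHom.mem_ker]
    rw [partialEval_last, map_eq_zero_iff _ (C_injective _ _)]

end Chains

/-! ### Immediate valuations and normal forms of polynomials -/

section ImmediateValuations

open IsLocalRing Polynomial

/-- A valuation on `K'` with valuation ring `V'` that makes `K'` an immediate extension of `K`, the
valuation ring of `K` being `V`. -/
structure IsImmediateValuation (V V' K : Type*) {K' Γ : Type*} [CommRing V] [CommRing V'] [Field K]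
    [Field K'] [Algebra V K] [Algebra V' K'] [Algebra K K'] [LinearOrderedCommGroupWithZero Γ]
    (v : Valuation K' Γ) : Prop where
  integers : v.Integers V'
  le_one_iff : ∀ c : K, v (algebraMap K K' c) ≤ 1 ↔ c ∈ Set.range (algebraMap V K)
  exists_lt : ∀ z : K', z ≠ 0 → ∃ c : K, v (z - algebraMap K K' c) < v z

theorem ValuationRing.integers_valuation (A F : Type*) [CommRing A] [IsDomain A] [ValuationRing A]
    [Field F] [Algebra A F] [IsFractionRing A F] : (ValuationRing.valuation A F).Integers A where
  hom_inj := IsFractionRing.injective A F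
  map_le_one a := (ValuationRing.mem_integer_iff A F _).2 ⟨a, rfl⟩
  exists_of_le_one _ h := (ValuationRing.mem_integer_iff A F _).1 h

theorem Valuation.Integers.lt_one_iff_mem_maximalIdeal {A F Γ : Type*} [CommRing A] [IsLocalRing A]
    [Field F] [Algebra A F] [LinearOrderedCommGroupWithZero Γ] {v : Valuation F Γ}
    (hv : v.Integers A) (a : A) : v (algebraMap A F a) < 1 ↔ a ∈ maximalIdeal A := by
  rw [mem_maximalIdeal, mem_nonunits_iff, hv.isUnit_iff_valuation_eq_one]
  exact ⟨fun h => h.ne, fun h => lt_of_le_of_ne (hv.map_le_one a) h⟩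

/-- A scalar `c` with the value of `z` comes from the value group, and `b ∈ V` with the residue of
`z / c` from the residue field; then `b * c` approximates `z` to higher order. -/
theorem IsImmediateExtension.isImmediateValuation {V V' K K' : Type*}
    [CommRing V] [IsDomain V] [ValuationRing V] [Field K] [Algebra V K] [IsFractionRing V K]
    [CommRing V'] [IsDomain V'] [ValuationRing V'] [Field K'] [Algebra V' K']
    [IsFractionRing V' K'] [Algebra V V'] [Algebra K K'] [Algebra V K']
    [IsScalarTower V V' K'] [IsScalarTower V K K'] (h : IsImmediateExtension V V' K K') :
    IsImmediateValuation V V' K (ValuationRing.valuation V' K') := by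
  have hv' := ValuationRing.integers_valuation V' K'
  obtain ⟨φ, hφ⟩ := h.valueGroup_iso
  have := h.isLocalHom
  refine ⟨hv', fun c => ?_, fun z hz => ?_⟩
  · have h1 := ValuationRing.mem_integer_iff V K c
    rw [Valuation.mem_integer_iff] at h1
    rw [← hφ, Set.mem_range, ← h1, ← map_one φ]
    exact map_le_map_iff φ
  · obtain ⟨γ, hγ⟩ := φ.surjective (ValuationRing.valuation V' K' z)
    obtain ⟨c, rfl⟩ := Quotient.mk''_surjective γ
    replace hγ : ValuationRing.valuation V' K' (algebraMap K K' c) =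
      ValuationRing.valuation V' K' z := (hφ c).symm.trans hγ
    have hc : algebraMap K K' c ≠ 0 := by
      intro h0
      rw [h0, map_zero] at hγ
      exact hz ((Valuation.zero_iff _).1 hγ.symm)
    obtain ⟨a, ha⟩ := hv'.exists_of_le_one (r := z / algebraMap K K' c) (by
      rw [map_div₀, hγ, div_self ((Valuation.ne_zero_iff _).2 hz)])
    obtain ⟨b, hb⟩ := h.residueField_bijective.2 (residue V' a)
    obtain ⟨b, rfl⟩ := residue_surjective b
    rw [ResidueField.map_residue] at hb
    have hab : a - algebraMap V V' b ∈ maximalIdeal V' := by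
      rw [← residue_eq_zero_iff, map_sub, hb, sub_self]
    refine ⟨algebraMap V K b * c, ?_⟩
    have h2 : z - algebraMap K K' (algebraMap V K b * c) =
        algebraMap V' K' (a - algebraMap V V' b) * algebraMap K K' c := by
      rw [map_sub, ha, map_mul, ← IsScalarTower.algebraMap_apply V K K',
        ← IsScalarTower.algebraMap_apply V V' K', sub_mul, div_mul_cancel₀ _ hc]
    rw [h2, map_mul, hγ]
    exact mul_lt_of_lt_one_left ((Valuation.pos_iff _).2 hz)
      ((hv'.lt_one_iff_mem_maximalIdeal _).2 hab)

variable {V V' K K' Γ : Type*} [CommRing V] [CommRing V'] [Field K]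
    [Field K'] [Algebra V K] [Algebra V' K'] [Algebra K K'] [LinearOrderedCommGroupWithZero Γ]
    {v : Valuation K' Γ}

theorem IsImmediateValuation.exists_valuation_eq (H : IsImmediateValuation V V' K v) (z : K')
    (hz : z ≠ 0) : ∃ c : K, c ≠ 0 ∧ v (algebraMap K K' c) = v z := by
  obtain ⟨c, hc⟩ := H.exists_lt z hz
  have h : v (algebraMap K K' c) = v z := by
    rw [Valuation.map_sub_swap] at hc
    have := Valuation.map_add_eq_of_lt_left v hc
    rwa [add_sub_cancel] at this
  refine ⟨c, ?_, h⟩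
  rintro rfl
  rw [map_zero, map_zero] at h
  exact hz ((Valuation.zero_iff _).1 h.symm)

theorem Polynomial.aeval_ne_zero_of_transcendental {x : K'} (hx : Transcendental K x) {q : K[X]}
    (hq : q ≠ 0) : aeval x q ≠ 0 :=
  fun h => hx ⟨q, hq, h⟩

/-- The polynomial `g` has smallest value at `x` among `X ^ n` and the members of exact degree `n`
made monic. For `s` with leading coefficient `c`, the bound follows from `v(c) * v((s/c)(x)) =
v(s(x)) ≤ 1`. -/
theorem Polynomial.exists_monic_forall_valuation_le_one (x : K') (n : ℕ)
    (v : Valuation K' Γ) (S : Finset K[X]) (hS : ∀ s ∈ S, s.natDegree ≤ n ∧ v (aeval x s) ≤ 1) :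
    ∃ g : K[X], g.Monic ∧ g.natDegree = n ∧
      ∀ s ∈ S, v (algebraMap K K' (s.coeff n)) * v (aeval x g) ≤ 1 := by
  classical
  induction S using Finset.induction_on with
  | empty => exact ⟨X ^ n, monic_X_pow n, natDegree_X_pow n, by simp⟩
  | insert s S hs ih =>
    obtain ⟨g, hg, hgn, hgS⟩ := ih fun s hs => hS s (Finset.mem_insert_of_mem hs)
    by_cases h0 : s.coeff n = 0
    · refine ⟨g, hg, hgn, fun t ht => ?_⟩
      rcases Finset.mem_insert.1 ht with rfl | ht
      · simp [h0]
      · exact hgS t ht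
    · obtain ⟨hsn, hsv⟩ := hS s (Finset.mem_insert_self _ _)
      have hsn' : s.natDegree = n := le_antisymm hsn (le_natDegree_of_ne_zero h0)
      have hlc : s.leadingCoeff = s.coeff n := by rw [leadingCoeff, hsn']
      have hs0 : s ≠ 0 := fun h => h0 (by simp [h])
      let g' := s * C (s.leadingCoeff)⁻¹
      have hg' : g'.Monic := monic_mul_leadingCoeff_inv hs0
      have hgn' : g'.natDegree = n := by
        rw [natDegree_mul_leadingCoeff_inv _ hs0, hsn']
      have hc : v (algebraMap K K' (s.coeff n)) * v (aeval x g') ≤ 1 := by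
        have h1 : aeval x g' * algebraMap K K' (s.coeff n) = aeval x s := by
          simp only [g', map_mul, aeval_C, hlc, map_inv₀]
          rw [mul_assoc, inv_mul_cancel₀, mul_one]
          exact (_root_.map_ne_zero _).2 h0
        rw [← map_mul, mul_comm, h1]
        exact hsv
      rcases le_total (v (aeval x g)) (v (aeval x g')) with h | h
      · refine ⟨g, hg, hgn, fun t ht => ?_⟩
        rcases Finset.mem_insert.1 ht with rfl | ht
        · exact (mul_le_mul_right h _).trans hc
        · exact hgS t ht
      · refine ⟨g', hg', hgn', fun t ht => ?_⟩
        rcases Finset.mem_insert.1 ht with rfl | ht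
        · exact hc
        · exact (mul_le_mul_right h _).trans (hgS t ht)

/-- Finitely many polynomials of degree at most `n` with integral values at `x` are `V`-linear
combinations of one quotient `g / e`, with `g` monic of degree `n`, and polynomials of degree less
than `n` with integral values. -/
theorem IsImmediateValuation.exists_monic_and_decomposition (H : IsImmediateValuation V V' K v)
    {x : K'} (hx : Transcendental K x) {n : ℕ} (hn : n ≠ 0) (S : Finset K[X])
    (hS : ∀ s ∈ S, s.natDegree ≤ n ∧ v (aeval x s) ≤ 1) :
    ∃ (g : K[X]) (e : K), g.Monic ∧ g.natDegree = n ∧ e ≠ 0 ∧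
      v (aeval x g) < v (algebraMap K K' e) ∧
      ∀ s ∈ S, ∃ (b : V) (h : K[X]), h.degree < n ∧ v (aeval x h) ≤ 1 ∧
        s = C (algebraMap V K b / e) * g + h := by
  obtain ⟨g, hg, hgn, hgS⟩ := exists_monic_forall_valuation_le_one x n v S hS
  have hg0 : aeval x g ≠ 0 := aeval_ne_zero_of_transcendental hx hg.ne_zero
  obtain ⟨e, he, hev⟩ := H.exists_valuation_eq _ hg0
  -- The scalar `e` keeps the value of the original `g(x)`, while subtracting `c` strictly lowers
  -- it; this puts the quotient in the maximal ideal. The result stays monic because `n ≠ 0`.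
  obtain ⟨c, hc⟩ := H.exists_lt _ hg0
  have hgX : (g - C c).Monic := by
    refine hg.sub_of_left (lt_of_le_of_lt degree_C_le ?_)
    rw [degree_eq_natDegree hg.ne_zero, hgn]
    exact_mod_cast Nat.pos_of_ne_zero hn
  have hgd : (g - C c).natDegree = n := by rw [natDegree_sub_C, hgn]
  have hval : v (aeval x (g - C c)) < v (aeval x g) := by
    rw [map_sub, aeval_C]; exact hc
  refine ⟨g - C c, e, hgX, hgd, he, hev ▸ hval, fun s hs => ?_⟩
  obtain ⟨hsn, hsv⟩ := hS s hs
  obtain ⟨b, hb⟩ := (H.le_one_iff (s.coeff n * e)).1 (by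
    rw [map_mul, map_mul, hev]; exact hgS s hs)
  have hbe : algebraMap V K b / e = s.coeff n := by rw [hb, mul_div_cancel_right₀ _ he]
  refine ⟨b, s - C (s.coeff n) * (g - C c), ?_, ?_, by rw [hbe]; ring⟩
  · rw [degree_lt_iff_coeff_zero]
    intro m hm
    rcases hm.lt_or_eq with h | rfl
    · rw [coeff_eq_zero_of_natDegree_lt]
      refine lt_of_le_of_lt ?_ h
      refine (natDegree_sub_le _ _).trans (max_le hsn ?_)
      exact (natDegree_C_mul_le _ _).trans hgd.le
    · rw [coeff_sub, coeff_C_mul]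
      have : (g - C c).coeff n = 1 := by
        have := hgX.coeff_natDegree
        rwa [hgd] at this
      rw [this, mul_one, sub_self]
  · rw [map_sub, map_mul, aeval_C]
    refine (Valuation.map_sub _ _ _).trans (max_le hsv ?_)
    rw [map_mul]
    exact (mul_le_mul_right hval.le _).trans (hgS s hs)

/-- Expansion of a polynomial in powers of a monic polynomial. -/
theorem Polynomial.exists_eq_sum_mul_pow {g : K[X]} (hg : g.Monic) (hg0 : g.natDegree ≠ 0)
    (q : K[X]) : ∃ (N : ℕ) (h : ℕ → K[X]), (∀ j, (h j).degree < g.degree) ∧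
      q = ∑ j ∈ Finset.range N, h j * g ^ j := by
  induction hq : q.natDegree using Nat.strong_induction_on generalizing q with
  | _ n ih =>
  have hg1 : g ≠ 1 := fun h => hg0 (by simp [h])
  have hgpos : 0 < g.natDegree := Nat.pos_of_ne_zero hg0
  by_cases hlt : q.natDegree < g.natDegree
  · refine ⟨1, fun j => if j = 0 then q else 0, fun j => ?_, by simp⟩
    dsimp only
    split_ifs
    · exact degree_lt_degree hlt
    · rw [degree_zero, degree_eq_natDegree hg.ne_zero]; exact WithBot.bot_lt_coe _
  · obtain ⟨N, h, hh, hsum⟩ := ih _ (by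
      rw [natDegree_divByMonic q hg, ← hq]; omega) (q /ₘ g) rfl
    refine ⟨N + 1, fun j => if j = 0 then q %ₘ g else h (j - 1), fun j => ?_, ?_⟩
    · dsimp only
      split_ifs
      · exact degree_modByMonic_lt q hg
      · exact hh _
    · rw [Finset.sum_range_succ']
      simp only [Nat.add_eq_zero_iff, one_ne_zero, and_false, if_false, if_true, pow_zero, mul_one,
        Nat.add_sub_cancel]
      conv_lhs => rw [← modByMonic_add_div q g, hsum, Finset.mul_sum]
      rw [add_comm]
      congr 1
      refine Finset.sum_congr rfl fun j _ => ?_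
      ring

/-- Every polynomial is a scalar multiple of a polynomial whose value at `x` is a unit. -/
theorem IsImmediateValuation.exists_normalization (H : IsImmediateValuation V V' K v)
    {x : K'} (hx : Transcendental K x) {n : ℕ} (hn : n ≠ 0) (h : K[X]) (hh : h.degree < n) :
    ∃ (c : K) (h' : K[X]), h'.degree < n ∧ v (aeval x h') = 1 ∧ h = C c * h' := by
  by_cases h0 : h = 0
  · refine ⟨0, 1, ?_, by simp, by simp [h0]⟩
    rw [degree_one]; exact_mod_cast Nat.pos_of_ne_zero hn
  · have h1 : aeval x h ≠ 0 := aeval_ne_zero_of_transcendental hx h0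
    obtain ⟨c, hc, hcv⟩ := H.exists_valuation_eq _ h1
    refine ⟨c, C c⁻¹ * h, ?_, ?_, ?_⟩
    · rwa [degree_C_mul (inv_ne_zero hc)]
    · rw [map_mul, aeval_C, map_inv₀, map_mul, map_inv₀, hcv,
        inv_mul_cancel₀ ((Valuation.ne_zero_iff _).2 h1)]
    · rw [← mul_assoc, ← C_mul, mul_inv_cancel₀ hc, C_1, one_mul]

end ImmediateValuations

/-! ### Extending a relation chain -/

section ChainConstruction

open IsLocalRing

/-- The localization, inside `V'`, of `V[y i, i < r]` at the elements that are units of `V'`. -/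
def centerLocalization (V : Type*) {V' : Type*} [CommRing V] [CommRing V'] [Algebra V V']
    (y : ℕ → V') (r : ℕ) : Subalgebra V V' where
  carrier := {w | ∃ p ∈ Algebra.adjoin V (y '' Set.Iio r), ∃ s ∈ Algebra.adjoin V (y '' Set.Iio r),
    IsUnit s ∧ w * s = p}
  mul_mem' := by
    rintro a b ⟨p, hp, s, hs, hsu, h⟩ ⟨p', hp', s', hs', hsu', h'⟩
    exact ⟨p * p', mul_mem hp hp', s * s', mul_mem hs hs', hsu.mul hsu', by rw [← h, ← h']; ring⟩
  add_mem' := by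
    rintro a b ⟨p, hp, s, hs, hsu, h⟩ ⟨p', hp', s', hs', hsu', h'⟩
    exact ⟨p * s' + p' * s, add_mem (mul_mem hp hs') (mul_mem hp' hs), s * s', mul_mem hs hs',
      hsu.mul hsu', by rw [← h, ← h']; ring⟩
  algebraMap_mem' a := ⟨_, algebraMap_mem _ a, 1, one_mem _, isUnit_one, mul_one _⟩

section

variable {V V' : Type*} [CommRing V] [CommRing V'] [Algebra V V'] {y : ℕ → V'} {r : ℕ}

theorem adjoin_le_centerLocalization :
    Algebra.adjoin V (y '' Set.Iio r) ≤ centerLocalization V y r :=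
  fun p hp => ⟨p, hp, 1, one_mem _, isUnit_one, mul_one _⟩

theorem centerLocalization_mono {r' : ℕ} (h : r ≤ r') :
    centerLocalization V y r ≤ centerLocalization V y r' := by
  have h1 : Algebra.adjoin V (y '' Set.Iio r) ≤ Algebra.adjoin V (y '' Set.Iio r') :=
    Algebra.adjoin_mono (Set.image_mono (Set.Iio_subset_Iio h))
  rintro w ⟨p, hp, s, hs, hsu, hw⟩
  exact ⟨p, h1 hp, s, h1 hs, hsu, hw⟩

theorem mem_centerLocalization_of_lt {i : ℕ} (h : i < r) : y i ∈ centerLocalization V y r :=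
  adjoin_le_centerLocalization (Algebra.subset_adjoin ⟨i, h, rfl⟩)

theorem mem_centerLocalization_of_mul_eq_one {s t : V'}
    (hs : s ∈ Algebra.adjoin V (y '' Set.Iio r)) (h : t * s = 1) :
    t ∈ centerLocalization V y r :=
  ⟨1, one_mem _, s, hs, IsUnit.of_mul_eq_one_right t h, h⟩

theorem centerLocalization_update {k : ℕ} (h : r ≤ k) (z : V') :
    centerLocalization V (Function.update y k z) r = centerLocalization V y r := by
  have : Function.update y k z '' Set.Iio r = y '' Set.Iio r :=
    Set.image_congr fun i (hi : i < r) => Function.update_of_ne (by omega) _ _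
  apply SetLike.coe_injective
  simp only [centerLocalization, this]

theorem exists_common_denominator (T : Finset V') (hT : ∀ t ∈ T, t ∈ centerLocalization V y r) :
    ∃ s ∈ Algebra.adjoin V (y '' Set.Iio r), IsUnit s ∧
      ∀ t ∈ T, t * s ∈ Algebra.adjoin V (y '' Set.Iio r) := by
  classical
  induction T using Finset.induction_on with
  | empty => exact ⟨1, one_mem _, isUnit_one, by simp⟩
  | insert t T _ ih =>
    obtain ⟨s, hs, hsu, h⟩ := ih fun t ht => hT t (Finset.mem_insert_of_mem ht)
    obtain ⟨p, hp, s', hs', hsu', h'⟩ := hT t (Finset.mem_insert_self _ _)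
    refine ⟨s * s', mul_mem hs hs', hsu.mul hsu', fun a ha => ?_⟩
    rcases Finset.mem_insert.1 ha with rfl | ha
    · rw [mul_left_comm, h']
      exact mul_mem hs hp
    · rw [← mul_assoc]
      exact mul_mem (h a ha) hs'

theorem mem_centerLocalization_of_mul_mem {t s : V'} (hs : s ∈ centerLocalization V y r)
    (hsu : IsUnit s) (hts : t * s ∈ centerLocalization V y r) : t ∈ centerLocalization V y r := by
  obtain ⟨a, ha, b, hb, hbu, h⟩ := hs
  obtain ⟨a', ha', b', hb', hbu', h'⟩ := hts
  refine ⟨a' * b, mul_mem ha' hb, a * b', mul_mem ha hb', (h ▸ hsu.mul hbu).mul hbu', ?_⟩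
  rw [← h, ← h']
  ring

theorem exists_aeval_eq_of_mem_adjoin {w : V'} (hw : w ∈ Algebra.adjoin V (y '' Set.Iio r)) :
    ∃ f : MvPolynomial (Fin r) V, MvPolynomial.aeval (fun k : Fin r => y k) f = w := by
  have h : y '' Set.Iio r = Set.range (fun k : Fin r => y k) := by
    ext z
    constructor
    · rintro ⟨i, hi, rfl⟩
      exact ⟨⟨i, hi⟩, rfl⟩
    · rintro ⟨i, rfl⟩
      exact ⟨i, i.2, rfl⟩
  rw [h, Algebra.adjoin_range_eq_range_aeval] at hw
  exact hw

theorem mem_adjoin_iff_exists_supported {w : V'} {T : Set ℕ} :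
    w ∈ Algebra.adjoin V (y '' T) ↔
      ∃ p ∈ MvPolynomial.supported V T, MvPolynomial.aeval y p = w := by
  have h : Algebra.adjoin V (y '' T) = (MvPolynomial.supported V T).map (MvPolynomial.aeval y) := by
    rw [MvPolynomial.supported, AlgHom.map_adjoin, Set.image_image]
    simp
  rw [h]
  exact Subalgebra.mem_map

/-- At a point of the maximal ideal a polynomial is congruent to its constant coefficient, and `V →
V'` is local. Denominators in `V'` therefore come from polynomials invertible at the origin. -/
theorem isUnit_constantCoeff_of_isUnit_aeval [IsLocalRing V'] [IsLocalHom (algebraMap V V')]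
    {σ : Type*} {z : σ → V'} (hz : ∀ i, z i ∈ maximalIdeal V') {p : MvPolynomial σ V}
    (hp : IsUnit (MvPolynomial.aeval z p)) : IsUnit (MvPolynomial.constantCoeff p) := by
  refine (isUnit_map_iff (algebraMap V V') _).1 ?_
  have h1 := aeval_sub_algebraMap_constantCoeff_mem (maximalIdeal V') z hz p
  by_contra h2
  have h3 := add_mem h1 ((mem_maximalIdeal _).2 h2)
  rw [sub_add_cancel] at h3
  exact h3 hp

end

variable {V V' K K' Γ : Type*} [CommRing V] [IsDomain V] [ValuationRing V] [CommRing V']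
  [IsDomain V'] [ValuationRing V'] [Field K]
  [Field K'] [Algebra V K] [Algebra V' K'] [Algebra K K'] [LinearOrderedCommGroupWithZero Γ]
  [Algebra V V'] {v : Valuation K' Γ}

/-- The value of `q` at `x` is a polynomial in `y r` whose coefficients are products of scalars and
units of `V'` that lie in the localization of `V[y i, i < r]`. -/
def IsExpandable (V : Type*) {V' K K' : Type*} [CommRing V] [CommRing V'] [Field K] [Field K']
    [Algebra V V'] [Algebra V' K'] [Algebra K K'] (x : K') (y : ℕ → V') (r : ℕ)
    (q : Polynomial K) : Prop :=
  ∃ (N : ℕ) (c : ℕ → K) (u : ℕ → V'), (∀ j, u j ∈ centerLocalization V y r ∧ IsUnit (u j)) ∧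
    Polynomial.aeval x q =
      ∑ j ∈ Finset.range N, algebraMap K K' (c j) * algebraMap V' K' (u j * y r ^ j)

/-- Extending a chain by a new element. -/
theorem IsRelationChain.update [IsLocalHom (algebraMap V V')] {r : ℕ} {y : ℕ → V'}
    (hy : IsRelationChain V r y) {w : V'} (hw : w ∈ maximalIdeal V') {β : V} (hβ0 : β ≠ 0)
    (hβ : β ∈ maximalIdeal V) (N : ℕ) (b : ℕ → V) (u : ℕ → V')
    (hu : ∀ j < N, u j ∈ Algebra.adjoin V (y '' Set.Iio r) ∧ IsUnit (u j)) {e : ℕ} (he : e < N)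
    (hbe : b e = 1) (hb : ∀ j < e, b j ∈ maximalIdeal V)
    (hβw : algebraMap V V' β * w =
      ∑ j ∈ Finset.range N, algebraMap V V' (b j) * (u j * y r ^ j)) :
    IsRelationChain V (r + 1) (Function.update y (r + 1) w) := by
  classical
  have hp : ∀ j, ∃ p : MvPolynomial ℕ V, j < N → (p ∈ MvPolynomial.supported V (Set.Iio r) ∧
      MvPolynomial.aeval y p = u j ∧ IsUnit (MvPolynomial.constantCoeff p)) := by
    intro j
    by_cases hj : j < N
    · obtain ⟨p, hp, hpu⟩ := mem_adjoin_iff_exists_supported.1 (hu j hj).1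
      exact ⟨p, fun _ => ⟨hp, hpu, isUnit_constantCoeff_of_isUnit_aeval hy.mem
        (hpu ▸ (hu j hj).2)⟩⟩
    · exact ⟨0, fun h => absurd h hj⟩
  choose p hp using hp
  refine ⟨fun i => ?_, ?_, fun j hj => ?_⟩
  · by_cases hi : i = r + 1
    · subst hi; rwa [Function.update_self]
    · rw [Function.update_of_ne hi]; exact hy.mem i
  · rw [Function.update_of_ne (by omega)]; exact hy.transcendental
  · have hcongr : ∀ G ∈ MvPolynomial.supported V (Set.Iic j),
        MvPolynomial.aeval (Function.update y (r + 1) w) G = MvPolynomial.aeval y G :=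
      fun G hG => aeval_eq_of_mem_supported hG fun i (hi : i ≤ j) =>
        Function.update_of_ne (by omega) _ _
    rcases Nat.lt_succ_iff_lt_or_eq.1 hj with hj' | rfl
    · obtain ⟨β, G, h, e, h1, h2, h3, h4, h5, h6⟩ := hy.step j hj'
      refine ⟨β, G, h, e, h1, h2, h3, h4, h5, ?_⟩
      rw [hcongr G h3, Function.update_of_ne (by omega), h6]
    · have hsupp : ∑ i ∈ Finset.range N, MvPolynomial.C (b i) * (p i * MvPolynomial.X j ^ i) ∈
          MvPolynomial.supported V (Set.Iic j) := by
        have hX : (MvPolynomial.X j : MvPolynomial ℕ V) ∈ MvPolynomial.supported V (Set.Iic j) :=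
          MvPolynomial.X_mem_supported.2 (Set.mem_Iic.2 le_rfl)
        have hC (a : V) : MvPolynomial.C a ∈ MvPolynomial.supported V (Set.Iic j) :=
          (MvPolynomial.supported V (Set.Iic j)).algebraMap_mem a
        refine Subalgebra.sum_mem _ fun i hi => ?_
        have hpi := MvPolynomial.supported_mono (R := V) (fun a (ha : a < j) => ha.le)
          (hp i (Finset.mem_range.1 hi)).1
        exact Subalgebra.mul_mem _ (hC _) (Subalgebra.mul_mem _ hpi (Subalgebra.pow_mem _ hX _))
      -- The factor `h` is the part of `G` from index `e` on, divided by `X j ^ e`; its constant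
      -- coefficient is that of `p e`, as `b e = 1`.
      refine ⟨β, ∑ i ∈ Finset.range N, MvPolynomial.C (b i) * (p i * MvPolynomial.X j ^ i),
        ∑ i ∈ Finset.Ico e N, MvPolynomial.C (b i) * (p i * MvPolynomial.X j ^ (i - e)), e, hβ0, hβ,
        hsupp, ?_, ?_, ?_⟩
      · rw [map_sum, Finset.sum_eq_single e]
        · simpa [hbe] using (hp e he).2.2
        · intro i hi hie
          have : i - e ≠ 0 := by have := (Finset.mem_Ico.1 hi).1; omega
          simp [this]
        · intro h; exact absurd (Finset.mem_Ico.2 ⟨le_rfl, he⟩) h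
      · rw [← MvPolynomial.mem_map_C_iff, ← Finset.sum_range_add_sum_Ico _ he.le, Finset.sum_mul]
        have h1 : ∑ i ∈ Finset.Ico e N, MvPolynomial.C (b i) *
            (p i * MvPolynomial.X j ^ (i - e)) * MvPolynomial.X j ^ e =
            ∑ i ∈ Finset.Ico e N, MvPolynomial.C (b i) * (p i * MvPolynomial.X j ^ i) := by
          refine Finset.sum_congr rfl fun i hi => ?_
          rw [mul_assoc, mul_assoc, ← pow_add, Nat.sub_add_cancel (Finset.mem_Ico.1 hi).1]
        rw [h1, add_sub_cancel_right]
        exact sum_mem fun i hi => Ideal.mul_mem_right _ _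
          (Ideal.mem_map_of_mem _ (hb i (Finset.mem_range.1 hi)))
      · rw [hcongr _ hsupp, Function.update_self, hβw, map_sum]
        refine Finset.sum_congr rfl fun i hi => ?_
        rw [map_mul, map_mul, map_pow, MvPolynomial.aeval_X, MvPolynomial.aeval_C,
          (hp i (Finset.mem_range.1 hi)).2.1]

open Polynomial

/-- Taking the first maximal index makes the earlier coefficients, divided by `c e`, fall into the
maximal ideal. -/
theorem exists_first_index_valuation_max {K K' Γ : Type*} [Field K] [Field K'] [Algebra K K']
    [LinearOrderedCommGroupWithZero Γ] (v : Valuation K' Γ) (N : ℕ) (hN : N ≠ 0) (c : ℕ → K) :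
    ∃ e < N, (∀ j < N, v (algebraMap K K' (c j)) ≤ v (algebraMap K K' (c e))) ∧
      ∀ j < e, v (algebraMap K K' (c j)) < v (algebraMap K K' (c e)) := by
  classical
  have hex : ∃ e, e < N ∧ ∀ j < N, v (algebraMap K K' (c j)) ≤ v (algebraMap K K' (c e)) := by
    obtain ⟨e, he, h⟩ := (Finset.range N).exists_max_image (fun j => v (algebraMap K K' (c j)))
      ⟨0, Finset.mem_range.2 (Nat.pos_of_ne_zero hN)⟩
    exact ⟨e, Finset.mem_range.1 he, fun j hj => h j (Finset.mem_range.2 hj)⟩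
  obtain ⟨h1, h2⟩ := Nat.find_spec hex
  refine ⟨Nat.find hex, h1, h2, fun j hj => ?_⟩
  by_contra h3
  exact Nat.find_min hex hj ⟨lt_trans hj h1, fun i hi => (h2 i hi).trans (not_lt.1 h3)⟩

variable [IsFractionRing V K] [Algebra V K'] [IsScalarTower V V' K'] [IsScalarTower V K K']

/-- If `g / e` has an integral value, a chain along which `g` is expandable either has `g / e` in
its localization, or can be extended by a unit multiple of `g / e`. -/
theorem IsImmediateValuation.exists_chain_extension [IsLocalHom (algebraMap V V')]
    (H : IsImmediateValuation V V' K v) {x : K'} {r : ℕ}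
    {y : ℕ → V'} (hy : IsRelationChain V r y) {g : K[X]} (hg0 : aeval x g ≠ 0) {e : K}
    (hge : v (aeval x g) < v (algebraMap K K' e)) (hg : IsExpandable V x y r g) :
    (∃ z ∈ centerLocalization V y (r + 1), algebraMap V' K' z = aeval x g / algebraMap K K' e) ∨
    ∃ w t : V', t ∈ centerLocalization V y (r + 1) ∧ IsUnit t ∧
      IsRelationChain V (r + 1) (Function.update y (r + 1) w) ∧
      algebraMap V' K' (w * t) = aeval x g / algebraMap K K' e := by
  obtain ⟨N, c, u, hu, hsum⟩ := hg
  have hN : N ≠ 0 := by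
    rintro rfl
    exact hg0 (by simpa using hsum)
  have he0 : algebraMap K K' e ≠ 0 := by
    intro h
    rw [h, map_zero] at hge
    exact not_lt_zero hge
  obtain ⟨k, hkN, hmax, hmin⟩ := exists_first_index_valuation_max v N hN c
  -- If every `c j / e` is integral, the expansion itself expresses the quotient; otherwise dividing
  -- by `c k` instead gives a new relation with `β = e / c k` in the maximal ideal.
  rcases le_or_gt (v (algebraMap K K' (c k))) (v (algebraMap K K' e)) with hle | hlt
  · left
    have hb : ∀ j, ∃ b : V, j < N → algebraMap V K b = c j / e := by
      intro j
      by_cases hj : j < N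
      · obtain ⟨b, hb⟩ := (H.le_one_iff (c j / e)).1 (by
          rw [map_div₀, map_div₀]
          exact div_le_one_of_le₀ ((hmax j hj).trans hle) zero_le)
        exact ⟨b, fun _ => hb⟩
      · exact ⟨0, fun h => absurd h hj⟩
    choose b hb using hb
    refine ⟨∑ j ∈ Finset.range N, algebraMap V V' (b j) * (u j * y r ^ j), ?_, ?_⟩
    · refine sum_mem fun j _ => mul_mem (Subalgebra.algebraMap_mem _ _) (mul_mem ?_
        (pow_mem (mem_centerLocalization_of_lt (Nat.lt_succ_self r)) _))
      exact centerLocalization_mono (Nat.le_succ r) (hu j).1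
    · rw [hsum, map_sum, Finset.sum_div]
      refine Finset.sum_congr rfl fun j hj => ?_
      rw [map_mul, ← IsScalarTower.algebraMap_apply V V' K', IsScalarTower.algebraMap_apply V K K',
        hb j (Finset.mem_range.1 hj), map_div₀]
      ring
  · right
    have hd0 : algebraMap K K' (c k) ≠ 0 := by
      intro h
      rw [h, map_zero] at hlt
      exact not_lt_zero hlt
    have hck : c k ≠ 0 := fun h => hd0 (by rw [h, map_zero])
    have he0' : e ≠ 0 := fun h => he0 (by rw [h, map_zero])
    classical
    obtain ⟨s, hs, hsu, hsuj⟩ := exists_common_denominator (y := y) (r := r)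
      ((Finset.range N).image u) fun a ha => by
        obtain ⟨j, -, rfl⟩ := Finset.mem_image.1 ha
        exact (hu j).1
    have hmaxIdeal : ∀ b : V, v (algebraMap K K' (algebraMap V K b)) < 1 → b ∈ maximalIdeal V := by
      intro b hb
      rw [← IsScalarTower.algebraMap_apply, IsScalarTower.algebraMap_apply V V' K',
        H.integers.lt_one_iff_mem_maximalIdeal] at hb
      intro hbu
      exact hb (hbu.map _)
    have hb : ∀ j, ∃ b : V, j < N → algebraMap V K b = c j / c k := by
      intro j
      by_cases hj : j < N
      · obtain ⟨b, hb⟩ := (H.le_one_iff (c j / c k)).1 (by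
          rw [map_div₀, map_div₀]
          exact div_le_one_of_le₀ (hmax j hj) zero_le)
        exact ⟨b, fun _ => hb⟩
      · exact ⟨0, fun h => absurd h hj⟩
    choose b hb using hb
    have hβlt : v (algebraMap K K' (e / c k)) < 1 := by
      rw [map_div₀, map_div₀]
      exact (div_lt_one₀ (lt_of_le_of_lt zero_le hlt)).2 hlt
    obtain ⟨β, hβ⟩ := (H.le_one_iff (e / c k)).1 hβlt.le
    have hzlt : v (aeval x g / algebraMap K K' e) < 1 := by
      rw [map_div₀]
      exact (div_lt_one₀ (lt_of_le_of_lt zero_le hge)).2 hge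
    obtain ⟨z, hz⟩ := H.integers.exists_of_le_one hzlt.le
    have hzm : z ∈ maximalIdeal V' := by
      rw [← H.integers.lt_one_iff_mem_maximalIdeal, hz]; exact hzlt
    obtain ⟨t, hts⟩ := hsu.exists_left_inv
    -- The new coordinate is `z * s`, where `s` clears the denominators of all the `u j`; its
    -- inverse `t` recovers `z`.
    refine ⟨z * s, t, centerLocalization_mono (Nat.le_succ r)
      (mem_centerLocalization_of_mul_eq_one hs hts), IsUnit.of_mul_eq_one s hts, ?_, ?_⟩
    · refine hy.update (Ideal.mul_mem_right _ _ hzm) (β := β) ?_ (hmaxIdeal β (hβ ▸ hβlt)) N b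
        (fun j => u j * s) (fun j hj => ⟨hsuj _ (Finset.mem_image_of_mem u (Finset.mem_range.2 hj)),
          (hu j).2.mul hsu⟩) hkN ?_ ?_ ?_
      · rintro rfl
        rw [map_zero] at hβ
        exact div_ne_zero he0' hck hβ.symm
      · apply IsFractionRing.injective V K
        rw [hb k hkN, div_self hck, map_one]
      · intro j hj
        have hjN := lt_trans hj hkN
        apply hmaxIdeal
        rw [hb j hjN, map_div₀, map_div₀]
        exact (div_lt_one₀ (lt_of_le_of_lt zero_le hlt)).2 (hmin j hj)
      · apply H.integers.hom_inj
        rw [map_mul, ← IsScalarTower.algebraMap_apply V V' K', IsScalarTower.algebraMap_apply V K K',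
          hβ, map_mul, hz, hsum, map_sum, Finset.sum_div, Finset.sum_mul, Finset.mul_sum]
        refine Finset.sum_congr rfl fun j hj => ?_
        rw [map_mul (algebraMap V' K') (algebraMap V V' (b j)),
          ← IsScalarTower.algebraMap_apply V V' K', IsScalarTower.algebraMap_apply V K K',
          hb j (Finset.mem_range.1 hj), map_div₀, map_div₀]
        simp only [map_mul]
        field_simp
    · rw [mul_assoc, mul_comm s t, hts, mul_one, hz]

end ChainConstruction

/-! ### Existence of relation chains, by induction on the degree -/

section ChainExistence

open IsLocalRing Polynomial

variable {V V' K K' Γ : Type*} [CommRing V] [CommRing V'] [Field K] [Field K'] [Algebra V' K']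
  [Algebra K K'] [Algebra V V']

/-- An expansion in powers of `g` gives an expansion in powers of `y r`, if `g` has, up to a scalar
and a unit, the value `y r`. -/
theorem isExpandable_of_eq_sum_mul_pow {x : K'} {y : ℕ → V'} {r : ℕ} {g q : K[X]} {e : K} {t : V'}
    (ht : t ∈ centerLocalization V y r) (htu : IsUnit t)
    (hg : aeval x g = algebraMap V' K' (y r * t) * algebraMap K K' e) {N : ℕ} {h : ℕ → K[X]}
    (hq : q = ∑ j ∈ Finset.range N, h j * g ^ j) {c : ℕ → K} {f : ℕ → K[X]}
    (hf : ∀ j, h j = C (c j) * f j)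
    (hfu : ∀ j < N, ∃ u ∈ centerLocalization V y r, IsUnit u ∧ algebraMap V' K' u = aeval x (f j)) :
    IsExpandable V x y r q := by
  have hfu' : ∀ j, ∃ u : V', (u ∈ centerLocalization V y r ∧ IsUnit u) ∧
      (j < N → algebraMap V' K' u = aeval x (f j)) := by
    intro j
    by_cases hj : j < N
    · obtain ⟨u, hu, huu, h⟩ := hfu j hj
      exact ⟨u, ⟨hu, huu⟩, fun _ => h⟩
    · exact ⟨1, ⟨one_mem _, isUnit_one⟩, fun h => absurd h hj⟩
  choose u hu huf using hfu'
  refine ⟨N, fun j => c j * e ^ j, fun j => u j * t ^ j,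
    fun j => ⟨mul_mem (hu j).1 (pow_mem ht j), (hu j).2.mul (htu.pow j)⟩, ?_⟩
  rw [hq, map_sum]
  refine Finset.sum_congr rfl fun j hj => ?_
  rw [hf, map_mul, map_mul, aeval_C, map_pow, hg, ← huf j (Finset.mem_range.1 hj)]
  simp only [map_mul, map_pow]
  ring

variable [IsDomain V] [ValuationRing V] [IsDomain V'] [ValuationRing V'] [Algebra V K]
  [LinearOrderedCommGroupWithZero Γ] {v : Valuation K' Γ} [IsFractionRing V K] [Algebra V K']
  [IsScalarTower V V' K'] [IsScalarTower V K K']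

/-- Finitely many polynomials with integral values at `x` have their values in the localization
given by one chain, along whose last element finitely many given polynomials are expandable. -/
theorem IsImmediateValuation.exists_isRelationChain [IsLocalHom (algebraMap V V')]
    (H : IsImmediateValuation V V' K v) {x : K'} (hx : Transcendental K x) (n : ℕ)
    (S Q : Finset K[X]) (hS : ∀ s ∈ S, s.natDegree ≤ n + 1 ∧ v (aeval x s) ≤ 1) :
    ∃ (r : ℕ) (y : ℕ → V'), IsRelationChain V r y ∧
      (∀ s ∈ S, ∃ w ∈ centerLocalization V y (r + 1), algebraMap V' K' w = aeval x s) ∧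
      ∀ q ∈ Q, IsExpandable V x y r q := by
  classical
  induction n generalizing S Q with
  | zero =>
    obtain ⟨g, e, hg, hgn, he, hval, hdec⟩ :=
      H.exists_monic_and_decomposition hx (by omega : 0 + 1 ≠ 0) S hS
    have he0 : algebraMap K K' e ≠ 0 := (_root_.map_ne_zero _).2 he
    have hconst : ∀ h : K[X], h.degree < ((0 + 1 : ℕ) : WithBot ℕ) → h = C (h.coeff 0) := by
      intro h hh
      apply eq_C_of_natDegree_le_zero
      by_cases h0 : h = 0
      · simp [h0]
      · have := (natDegree_lt_iff_degree_lt h0).2 hh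
        omega
    have hzlt : v (aeval x g / algebraMap K K' e) < 1 := by
      rw [map_div₀]
      exact (div_lt_one₀ (lt_of_le_of_lt zero_le hval)).2 hval
    obtain ⟨z, hz⟩ := H.integers.exists_of_le_one hzlt.le
    have hzm : z ∈ maximalIdeal V' := by
      rw [← H.integers.lt_one_iff_mem_maximalIdeal, hz]; exact hzlt
    have hztr : Transcendental V z := by
      have h1 : Transcendental K (aeval x (C e⁻¹ * g)) := by
        refine hx.aeval _ ?_ (mem_nonZeroDivisors_of_ne_zero ?_)
        · rw [natDegree_C_mul (inv_ne_zero he), hgn]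
          omega
        · exact leadingCoeff_ne_zero.2 (mul_ne_zero (C_ne_zero.2 (inv_ne_zero he)) hg.ne_zero)
      have h2 : aeval x (C e⁻¹ * g) = algebraMap V' K' z := by
        rw [hz, map_mul, aeval_C, map_inv₀, inv_mul_eq_div]
      rw [h2] at h1
      exact (transcendental_algebraMap_iff H.integers.hom_inj).1
        (h1.restrictScalars (IsFractionRing.injective V K))
    -- In degree at most one a single coordinate suffices; the later entries only have to lie in the
    -- maximal ideal.
    refine ⟨0, fun _ => z, ⟨fun _ => hzm, hztr, fun j hj => absurd hj (Nat.not_lt_zero j)⟩, ?_, ?_⟩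
    · intro s hs
      obtain ⟨b, h, hh, hhv, rfl⟩ := hdec s hs
      rw [hconst h hh, aeval_C] at hhv
      obtain ⟨a, ha⟩ := (H.le_one_iff _).1 hhv
      refine ⟨algebraMap V V' b * z + algebraMap V V' a, add_mem (mul_mem
        (Subalgebra.algebraMap_mem _ _) (mem_centerLocalization_of_lt (y := fun _ => z)
          (Nat.lt_succ_self 0))) (Subalgebra.algebraMap_mem _ _), ?_⟩
      rw [hconst h hh, map_add, map_add, map_mul, map_mul, hz, aeval_C, aeval_C,
        ← IsScalarTower.algebraMap_apply V V' K', IsScalarTower.algebraMap_apply V K K',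
        ← IsScalarTower.algebraMap_apply V V' K', IsScalarTower.algebraMap_apply V K K', ha,
        map_div₀]
      ring
    · intro q _
      obtain ⟨N, h, hh, hq⟩ := exists_eq_sum_mul_pow hg (by omega) q
      refine isExpandable_of_eq_sum_mul_pow (e := e) (one_mem _) isUnit_one ?_ hq
        (c := fun j => (h j).coeff 0) (f := fun _ => 1) (fun j => ?_)
        (fun j _ => ⟨1, one_mem _, isUnit_one, by simp⟩)
      · rw [mul_one, hz, div_mul_cancel₀ _ he0]
      · rw [mul_one]
        refine hconst _ ?_
        have := hh j
        rwa [degree_eq_natDegree hg.ne_zero, hgn] at this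
  | succ n ih =>
    obtain ⟨g, e, hg, hgn, he, hval, hdec⟩ :=
      H.exists_monic_and_decomposition hx (by omega : n + 1 + 1 ≠ 0) S hS
    have he0 : algebraMap K K' e ≠ 0 := (_root_.map_ne_zero _).2 he
    have hg0 : aeval x g ≠ 0 := aeval_ne_zero_of_transcendental hx hg.ne_zero
    have hdeg : ∀ h : K[X], h.degree < ((n + 1 + 1 : ℕ) : WithBot ℕ) → h.natDegree ≤ n + 1 := by
      intro h hh
      by_cases h0 : h = 0
      · simp [h0]
      · have := (natDegree_lt_iff_degree_lt h0).2 hh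
        omega
    have hdec' : ∀ s, ∃ (b : V) (h : K[X]), s ∈ S → (h.degree < ((n + 1 + 1 : ℕ) : WithBot ℕ) ∧
        v (aeval x h) ≤ 1 ∧ s = C (algebraMap V K b / e) * g + h) := by
      intro s
      by_cases hs : s ∈ S
      · obtain ⟨b, h, h'⟩ := hdec s hs
        exact ⟨b, h, fun _ => h'⟩
      · exact ⟨0, 0, fun h => absurd h hs⟩
    choose b p hbp using hdec'
    choose N h hh hq using exists_eq_sum_mul_pow hg (by omega : g.natDegree ≠ 0)
    have hnorm := fun q j => H.exists_normalization hx (by omega : n + 1 + 1 ≠ 0) (h q j) (by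
      have := hh q j
      rwa [degree_eq_natDegree hg.ne_zero, hgn] at this)
    choose c f hf hfv hcf using hnorm
    -- The lower-degree chain must accommodate the remainders of `S` and the normalized coefficients
    -- of the `g`-adic expansions of `Q`, and `g` itself must be expandable along it so that the
    -- chain can be extended.
    obtain ⟨r, y, hy, hyS, hyQ⟩ := ih
      (S.image p ∪ Q.biUnion fun q => (Finset.range (N q)).image (f q)) (insert g Q) (by
        intro s hs
        rcases Finset.mem_union.1 hs with hs | hs
        · obtain ⟨s', hs', rfl⟩ := Finset.mem_image.1 hs
          exact ⟨hdeg _ (hbp s' hs').1, (hbp s' hs').2.1⟩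
        · obtain ⟨q, _, hs⟩ := Finset.mem_biUnion.1 hs
          obtain ⟨j, _, rfl⟩ := Finset.mem_image.1 hs
          exact ⟨hdeg _ (hf q j), (hfv q j).le⟩)
    have hSval : ∀ (r' : ℕ) (y' : ℕ → V'), centerLocalization V y (r + 1) ≤
        centerLocalization V y' (r' + 1) → (∃ z ∈ centerLocalization V y' (r' + 1),
          algebraMap V' K' z = aeval x g / algebraMap K K' e) →
        ∀ s ∈ S, ∃ w ∈ centerLocalization V y' (r' + 1), algebraMap V' K' w = aeval x s := by
      rintro r' y' hle ⟨z, hz, hzg⟩ s hs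
      obtain ⟨w, hw, hwp⟩ := hyS (p s) (Finset.mem_union_left _ (Finset.mem_image_of_mem p hs))
      refine ⟨algebraMap V V' (b s) * z + w,
        add_mem (mul_mem (Subalgebra.algebraMap_mem _ _) hz) (hle hw), ?_⟩
      conv_rhs => rw [(hbp s hs).2.2]
      rw [map_add, map_add, map_mul, map_mul, hzg, hwp, aeval_C,
        ← IsScalarTower.algebraMap_apply V V' K', IsScalarTower.algebraMap_apply V K K',
        map_div₀]
      ring
    -- If the chain is unchanged, `Q` is expandable along the old `y r`; otherwise its `g`-adic
    -- expansions become expansions in the new coordinate.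
    rcases H.exists_chain_extension hy hg0 hval (hyQ g (Finset.mem_insert_self _ _)) with
      hz | ⟨w, t, ht, htu, hy', hwt⟩
    · exact ⟨r, y, hy, hSval r y le_rfl hz, fun q hq => hyQ q (Finset.mem_insert_of_mem hq)⟩
    · have hO : centerLocalization V (Function.update y (r + 1) w) (r + 1) =
          centerLocalization V y (r + 1) := centerLocalization_update le_rfl w
      have hle : centerLocalization V y (r + 1) ≤
          centerLocalization V (Function.update y (r + 1) w) (r + 1 + 1) :=
        hO ▸ centerLocalization_mono (Nat.le_succ _)
      refine ⟨r + 1, Function.update y (r + 1) w, hy', hSval _ _ hle ⟨w * t, mul_mem ?_ (hle ht),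
        hwt⟩, fun q hqQ => ?_⟩
      · have := mem_centerLocalization_of_lt (V := V) (y := Function.update y (r + 1) w)
          (Nat.lt_succ_self (r + 1))
        rwa [Function.update_self] at this
      · refine isExpandable_of_eq_sum_mul_pow (e := e) (hO ▸ ht) htu ?_ (hq q) (hcf q)
          fun j hj => ?_
        · rw [Function.update_self, hwt, div_mul_cancel₀ _ he0]
        · obtain ⟨u, hu, huf⟩ := hyS (f q j) (Finset.mem_union_right _ (Finset.mem_biUnion.2
            ⟨q, hqQ, Finset.mem_image_of_mem _ (Finset.mem_range.2 hj)⟩))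
          refine ⟨u, hO ▸ hu, ?_, huf⟩
          rw [H.integers.isUnit_iff_valuation_eq_one, huf, hfv]

end ChainExistence

/-! ### From finite subsets to the filtered union -/

section FilteredUnion

open IsLocalRing

theorem IsCompleteIntersectionAlgebra.finiteType {A : Type u} {B : Type v} [CommRing A]
    [CommRing B] [Algebra A B] (h : IsCompleteIntersectionAlgebra A B) :
    Algebra.FiniteType A B := by
  obtain ⟨G, _, _, P, hG, -, ⟨φ⟩⟩ := h
  have h1 : Algebra.FinitePresentation A G := hG.finitePresentation
  have h2 : Algebra.FiniteType A G := inferInstance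
  exact (h2.of_surjective (Ideal.Quotient.mkₐ A (Ideal.ofList P))
    (Ideal.Quotient.mkₐ_surjective A _)).equiv φ

/-- An algebra is the filtered union of its finitely generated subalgebras with a property if each
of its finite subsets lies in such a subalgebra. -/
theorem isFilteredUnionOf_of_forall_finset {A : Type u} {B : Type v} [CommRing A] [CommRing B]
    [Algebra A B] {p : Subalgebra A B → Prop} (hp : ∀ C, p C → C.FG)
    (h : ∀ T : Finset B, ∃ C, p C ∧ (T : Set B) ⊆ C) : IsFilteredUnionOf p := by
  classical
  refine ⟨{C | p C}, fun C hC => hC, fun C hC D hD => ?_, fun b => ?_⟩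
  · obtain ⟨s, rfl⟩ := hp C hC
    obtain ⟨t, rfl⟩ := hp D hD
    obtain ⟨E, hE, hst⟩ := h (s ∪ t)
    rw [Finset.coe_union, Set.union_subset_iff] at hst
    exact ⟨E, hE, Algebra.adjoin_le hst.1, Algebra.adjoin_le hst.2⟩
  · obtain ⟨C, hC, hb⟩ := h {b}
    exact ⟨C, hC, hb (by simp)⟩

variable {V : Type u} {V' : Type v} {K K' Γ : Type*} [CommRing V] [CommRing V'] [Field K]
  [Field K'] [Algebra V K] [Algebra V' K'] [Algebra K K'] [LinearOrderedCommGroupWithZero Γ]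
  {v : Valuation K' Γ}

/-- Every element of `V'` is a quotient of two values at `x` of polynomials, the denominator being
a unit of `V'`. -/
theorem IsImmediateValuation.exists_eq_div (H : IsImmediateValuation V V' K v) {x : K'}
    (hgen : IntermediateField.adjoin K {x} = ⊤) (t : V') :
    ∃ p q : Polynomial K, v (Polynomial.aeval x p) ≤ 1 ∧ v (Polynomial.aeval x q) = 1 ∧
      algebraMap V' K' t * Polynomial.aeval x q = Polynomial.aeval x p := by
  obtain ⟨p, q, hpq⟩ := (IntermediateField.mem_adjoin_simple_iff K (algebraMap V' K' t)).1
    (hgen ▸ IntermediateField.mem_top : _ ∈ IntermediateField.adjoin K {x})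
  by_cases hq : Polynomial.aeval x q = 0
  · rw [hq, div_zero] at hpq
    -- Division by zero gives zero here, so `t = 0` and the quotient `0 / 1` serves.
    exact ⟨0, 1, by simp, by simp, by simp [hpq]⟩
  · obtain ⟨c, hc, hcv⟩ := H.exists_valuation_eq _ hq
    have hq1 : v (Polynomial.aeval x (Polynomial.C c⁻¹ * q)) = 1 := by
      rw [map_mul, Polynomial.aeval_C, map_inv₀, map_mul, map_inv₀, hcv,
        inv_mul_cancel₀ ((Valuation.ne_zero_iff _).2 hq)]
    have h : algebraMap V' K' t * Polynomial.aeval x (Polynomial.C c⁻¹ * q) =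
        Polynomial.aeval x (Polynomial.C c⁻¹ * p) := by
      rw [map_mul, map_mul, mul_left_comm, hpq, div_mul_cancel₀ _ hq]
    refine ⟨_, _, ?_, hq1, h⟩
    rw [← h, map_mul, hq1, mul_one]
    exact H.integers.map_le_one t

variable [IsDomain V] [ValuationRing V] [IsDomain V'] [ValuationRing V'] [Algebra V V']
  [IsFractionRing V K] [Algebra V K'] [IsScalarTower V V' K'] [IsScalarTower V K K']

theorem IsImmediateValuation.exists_isRelationChain_forall_mem [IsLocalHom (algebraMap V V')]
    (H : IsImmediateValuation V V' K v) {x : K'} (hx : Transcendental K x)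
    (hgen : IntermediateField.adjoin K {x} = ⊤) (T : Finset V') :
    ∃ (r : ℕ) (y : ℕ → V'), IsRelationChain V r y ∧ ∀ t ∈ T, ∃ p ∈ centerLocalization V y (r + 1),
      ∃ s ∈ centerLocalization V y (r + 1), IsUnit s ∧ t * s = p := by
  classical
  choose p q hp hq hpq using H.exists_eq_div hgen
  obtain ⟨r, y, hy, hyS, -⟩ := H.exists_isRelationChain hx
    ((T.image p ∪ T.image q).sup Polynomial.natDegree) (T.image p ∪ T.image q) ∅ (by
      intro s hs
      refine ⟨(Finset.le_sup (f := Polynomial.natDegree) hs).trans (Nat.le_succ _), ?_⟩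
      rcases Finset.mem_union.1 hs with hs | hs
      · obtain ⟨t, -, rfl⟩ := Finset.mem_image.1 hs
        exact hp t
      · obtain ⟨t, -, rfl⟩ := Finset.mem_image.1 hs
        exact (hq t).le)
  refine ⟨r, y, hy, fun t ht => ?_⟩
  obtain ⟨a, ha, hap⟩ := hyS _ (Finset.mem_union_left _ (Finset.mem_image_of_mem p ht))
  obtain ⟨b, hb, hbq⟩ := hyS _ (Finset.mem_union_right _ (Finset.mem_image_of_mem q ht))
  refine ⟨a, ha, b, hb, ?_, H.integers.hom_inj ?_⟩
  · rw [H.integers.isUnit_iff_valuation_eq_one, hbq, hq]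
  · rw [map_mul, hap, hbq, hpq]

/-- If `V'` is an immediate extension of `V` and its fraction field is generated by one
transcendental element, each finite subset of `V'` lies in a complete intersection subalgebra. -/
theorem IsImmediateValuation.exists_isCompleteIntersectionAlgebra_finset
    [IsLocalHom (algebraMap V V')] (H : IsImmediateValuation V V' K v) {x : K'}
    (hx : Transcendental K x) (hgen : IntermediateField.adjoin K {x} = ⊤) (T : Finset V') :
    ∃ C : Subalgebra V V', IsCompleteIntersectionAlgebra V C ∧ (T : Set V') ⊆ C := by
  have hinj : Function.Injective (algebraMap V V') := by
    have h : Function.Injective (algebraMap V K') := by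
      rw [IsScalarTower.algebraMap_eq V K K']
      exact (algebraMap K K').injective.comp (IsFractionRing.injective V K)
    rw [IsScalarTower.algebraMap_eq V V' K', RingHom.coe_comp] at h
    exact h.of_comp
  obtain ⟨r, y, hy, hyT⟩ := H.exists_isRelationChain_forall_mem hx hgen T
  obtain ⟨s, hs, hsu, hT⟩ := exists_common_denominator T (y := y) (r := r + 1)
    fun t ht => by
      obtain ⟨p, hp, b, hb, hbu, h⟩ := hyT t ht
      exact mem_centerLocalization_of_mul_mem hb hbu (h ▸ hp)
  obtain ⟨s, rfl⟩ := exists_aeval_eq_of_mem_adjoin hs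
  obtain ⟨s₀, -, h⟩ := hy.exists_isCompleteIntersectionAlgebra hinj
  obtain ⟨C, hC, hmem⟩ := h s (isUnit_constantCoeff_of_isUnit_aeval (fun i => hy.mem _) hsu)
  refine ⟨C, hC, fun t ht => ?_⟩
  obtain ⟨f, hf⟩ := exists_aeval_eq_of_mem_adjoin (hT t ht)
  -- The subalgebra inverts `s₀ * s` rather than `s`, so the numerator is multiplied by `s₀` as
  -- well.
  refine hmem (s₀ * f) t ?_
  rw [map_mul, map_mul, hf]
  ring

end FilteredUnion

theorem theorem1p8
    {V : Type u} {V' : Type v} {K K' : Type*}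
    [CommRing V] [IsDomain V] [ValuationRing V] [Field K] [Algebra V K] [IsFractionRing V K]
    [CommRing V'] [IsDomain V'] [ValuationRing V'] [Field K'] [Algebra V' K']
    [IsFractionRing V' K']
    [Algebra V V'] [Algebra K K'] [Algebra V K']
    [IsScalarTower V V' K'] [IsScalarTower V K K']
    (himm : IsImmediateExtension V V' K K')
    (lam : Ordinal.{u}) (a : Set.Iio lam → V) (x : V')
    (hpc : IsPseudoConvergent (ValuationRing.valuation V K) (fun i => algebraMap V K (a i)))
    (halg : IsAlgebraicSeq V (ValuationRing.valuation V K) (fun i => algebraMap V K (a i)))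
    (hlim : IsPseudoLimit (ValuationRing.valuation V' K') (fun i => algebraMap V K' (a i))
      (algebraMap V' K' x))
    (hnolim : ¬ ∃ z : K,
      IsPseudoLimit (ValuationRing.valuation V K) (fun i => algebraMap V K (a i)) z)
    (htr : Transcendental K (algebraMap V' K' x))
    (hgen : IntermediateField.adjoin K {algebraMap V' K' x} = ⊤) :
    IsFilteredUnionOf (fun C : Subalgebra V V' => IsCompleteIntersectionAlgebra V C) ∨
      ∃ y : K', y ∉ Set.range (algebraMap K K') ∧
        ∃ (mu : Ordinal.{u}) (b : Set.Iio mu → V),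
          IsPseudoConvergent (ValuationRing.valuation V K) (fun i => algebraMap V K (b i)) ∧
          IsTranscendentalSeq V (ValuationRing.valuation V K) (fun i => algebraMap V K (b i)) ∧
          IsPseudoLimit (ValuationRing.valuation V' K') (fun i => algebraMap V K' (b i)) y ∧
          ¬ ∃ z : V, IsPseudoLimit (ValuationRing.valuation V K)
            (fun i => algebraMap V K (b i)) (algebraMap V K z) := by
  have := himm.isLocalHom
  exact Or.inl (isFilteredUnionOf_of_forall_finset
    (fun C hC => Subalgebra.fg_iff_finiteType C |>.2 hC.finiteType)
    (himm.isImmediateValuation.exists_isCompleteIntersectionAlgebra_finset htr hgen))
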